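/- Let $I$ be a closed two-sided ideal of a C*-algebra $A$, and let $H$ and $E$ be Hilbert C*-modules over $A$ that are countably generated, i.e. each has a countable subset whose $A$-linear span is dense. (Modules act on one fixed side throughout; right modules over $A$ are the same as left modules over the opposite algebra $A^{\mathrm{op}}$, and the formal text writes the algebra on the left.) Let $HI$ denote the closed submodule of $H$ spanned by the products of elements of $H$ with elements of $I$, and similarly $EI$; the quotients $H/HI$ and $E/EI$ are Hilbert C*-modules over $A/I$, with inner product $\langle x+HI,\,y+HI\rangle=\langle x,y\rangle+I$. An isomorphism of Hilbert C*-modules is a bijective module map that preserves the inner products. Let $\phi\colon H/HI\to E/EI$ be an isomorphism of Hilbert C*-modules over $A/I$. Then there is an isomorphism of Hilbert C*-modules over $A$ $$\Phi\colon H\oplus EI\to E\oplus HI$$ that lifts $\phi$, i.e. for $h\in H$ and $y\in EI$ the class modulo $EI$ of the first component of $\Phi(h,y)$ is $\phi(h+HI)$. Moreover, $\Phi$ can be chosen as follows: there is an adjointable operator $\psi\colon H\to E$ with $\|\psi\|\le 1$ that lifts $\phi$, i.e. $\psi(h)+EI=\phi(h+HI)$ for all $h\in H$, such that $$U=\begin{pmatrix}\psi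 & -\sqrt{1-\psi\psi^*}\\ \sqrt{1-\psi^*\psi} & \psi^*\end{pmatrix}\colon H\oplus E\to E\oplus H$$ is an isomorphism of Hilbert C*-modules and $\Phi$ is the restriction of $U$ to $H\oplus EI$. -/

import Mathlib

/-!
Related generators `x i` of `H` and `y i` of `E` (the class of `y i` is `φ` of the class of `x i`)
can be scaled so that `p = ∑ i, |x i⟩⟨x i|` and `q = ∑ i, |y i⟩⟨y i|` converge; these operators
are intertwined by `φ` modulo `I`, and so are their continuous functions. The functions
`c n t = n t² / (1 + n t²)` of `p` increase strongly to the identity, so the operators `g n` of `p`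
with `t (g n t)² = c (n + 1) t - c n t`, applied to the `x i`, yield a Parseval frame `u` of `H`.
In the same way `q` and the `y i` yield a Parseval frame `v` of `E`, whose members are related to
those of `u`. The map `x ↦ ∑ k, ⟪u k, x⟫ v k` is then an adjointable contraction `ψ` that lifts `φ`.

Since `φ` is unitary, `1 - ψ⋆ψ` maps `H` into `HI` and `1 - ψψ⋆` maps `E` into `EI`; so do their
square roots. Hence the Halmos unitary dilation of `ψ` carries `H ⊕ EI` onto `E ⊕ HI`.
-/

noncomputable section

namespace HilbertModule

open WithCStarModule

/-! Hilbert C⋆-modules are Mathlib's `CStarModule A E`, with `E` complete.  There the algebra `A` is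
written on the left, `⟪x, a • y⟫ = a * ⟪x, y⟫`; right modules over an algebra are the same as left
modules over the opposite algebra. -/

section Basic

variable {A : Type*} [NonUnitalCStarAlgebra A] [PartialOrder A] [StarOrderedRing A]

/-- A closed two-sided ideal of a C⋆-algebra is self-adjoint. -/
theorem star_mem_of_mem (I : TwoSidedIdeal A) [hI : IsClosed (I : Set A)] {x : A} (hx : x ∈ I) :
    star x ∈ I := by
  set b : A := x * star x with hb
  have hbI : b ∈ I := I.mul_mem_right _ _ hx
  have hbs : IsSelfAdjoint b := IsSelfAdjoint.mul_star_self x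
  rw [← SetLike.mem_coe, ← hI.closure_eq, Metric.mem_closure_iff]
  intro r hr
  obtain ⟨δ, hδ, hδr⟩ : ∃ δ : ℝ, 0 < δ ∧ δ < r ^ 2 :=
    ⟨r ^ 2 / 2, by positivity, half_lt_self (by positivity)⟩
  have hpos : ∀ t : ℝ, 0 < t ^ 2 + δ ^ 2 := fun t => by positivity
  have hcg : Continuous fun t : ℝ => t / (t ^ 2 + δ ^ 2) :=
    continuous_id.div (by fun_prop) fun t => (hpos t).ne'
  set g : A := cfcₙ (fun t : ℝ => t / (t ^ 2 + δ ^ 2)) b with hg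
  set f : A := cfcₙ (fun t : ℝ => t * (t / (t ^ 2 + δ ^ 2))) b with hf
  have hfg : f = b * g := by
    rw [hf, cfcₙ_mul (fun t : ℝ => t) (fun t : ℝ => t / (t ^ 2 + δ ^ 2)) b
      (by fun_prop) (by simp) hcg.continuousOn (by simp), cfcₙ_id' ℝ b]
  have hfI : f ∈ I := hfg ▸ I.mul_mem_right _ _ hbI
  have hcf : Continuous fun t : ℝ => t * (t / (t ^ 2 + δ ^ 2)) := continuous_id.mul hcg
  have hfs : star f = f := (cfcₙ_predicate (p := IsSelfAdjoint) _ b).star_eq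
  refine ⟨star x * f, I.mul_mem_left _ _ hfI, ?_⟩
  have hbf : b * f = cfcₙ (fun t : ℝ => t * (t * (t / (t ^ 2 + δ ^ 2)))) b := by
    rw [cfcₙ_mul (fun t : ℝ => t) (fun t : ℝ => t * (t / (t ^ 2 + δ ^ 2))) b
      (by fun_prop) (by simp) hcf.continuousOn (by simp), cfcₙ_id' ℝ b]
  have hcbf : Continuous fun t : ℝ => t * (t * (t / (t ^ 2 + δ ^ 2))) := continuous_id.mul hcf
  have hd : b - b * f =
      cfcₙ (fun t : ℝ => t - t * (t * (t / (t ^ 2 + δ ^ 2)))) b := by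
    rw [cfcₙ_sub (fun t : ℝ => t) (fun t : ℝ => t * (t * (t / (t ^ 2 + δ ^ 2)))) b
      (by fun_prop) (by simp) hcbf.continuousOn (by simp), cfcₙ_id' ℝ b, hbf]
  have hcd : Continuous fun t : ℝ => t - t * (t * (t / (t ^ 2 + δ ^ 2))) :=
    continuous_id.sub hcbf
  have hfd : f * (b - b * f) = cfcₙ (fun t : ℝ => (t * (t / (t ^ 2 + δ ^ 2))) *
      (t - t * (t * (t / (t ^ 2 + δ ^ 2))))) b := by
    rw [hd, hf, cfcₙ_mul (fun t : ℝ => t * (t / (t ^ 2 + δ ^ 2)))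
      (fun t : ℝ => t - t * (t * (t / (t ^ 2 + δ ^ 2)))) b
      hcf.continuousOn (by simp) hcd.continuousOn (by simp)]
  have key : star (star x - star x * f) * (star x - star x * f) =
      cfcₙ (fun t : ℝ => (t - t * (t * (t / (t ^ 2 + δ ^ 2)))) - (t * (t / (t ^ 2 + δ ^ 2))) *
      (t - t * (t * (t / (t ^ 2 + δ ^ 2))))) b := by
    rw [cfcₙ_sub (fun t : ℝ => t - t * (t * (t / (t ^ 2 + δ ^ 2))))
      (fun t : ℝ => (t * (t / (t ^ 2 + δ ^ 2))) *
      (t - t * (t * (t / (t ^ 2 + δ ^ 2))))) b hcd.continuousOn (by simp)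
      (hcf.mul hcd).continuousOn (by simp), ← hd, ← hfd]
    simp only [star_sub, star_mul, star_star, hfs, hb]
    noncomm_ring
  have hn : ‖star x - star x * f‖ * ‖star x - star x * f‖ ≤ δ := by
    rw [← CStarRing.norm_star_mul_self, key]
    refine norm_cfcₙ_le fun t _ => ?_
    have h0 := hpos t
    have : (t - t * (t * (t / (t ^ 2 + δ ^ 2)))) - (t * (t / (t ^ 2 + δ ^ 2))) *
      (t - t * (t * (t / (t ^ 2 + δ ^ 2)))) = t * δ ^ 4 / (t ^ 2 + δ ^ 2) ^ 2 := by
      field_simp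
      ring
    rw [this, Real.norm_eq_abs, abs_div, abs_of_pos (pow_pos h0 2), div_le_iff₀ (by positivity),
      abs_mul, abs_of_pos (pow_pos hδ 4)]
    have h1 : |t| * δ ≤ t ^ 2 + δ ^ 2 := by
      nlinarith [sq_nonneg (|t| - δ), sq_abs t, abs_nonneg t]
    have h2 : δ ^ 2 ≤ t ^ 2 + δ ^ 2 := by nlinarith [sq_nonneg t]
    have h3 : (|t| * δ) * δ ^ 2 ≤ (t ^ 2 + δ ^ 2) * (t ^ 2 + δ ^ 2) := by
      gcongr
    nlinarith
  rw [dist_eq_norm]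
  nlinarith [norm_nonneg (star x - star x * f)]

variable {E : Type*} [NormedAddCommGroup E] [NormedSpace ℂ E] [SMul A E] [CStarModule A E]

theorem ext_inner {x y : E} (h : ∀ z : E, inner A z x = inner A z y) : x = y := by
  rw [← sub_eq_zero, ← CStarModule.inner_self (A := A)]
  simp [CStarModule.inner_sub_right, h]

theorem alg_smul_add (a : A) (x y : E) : a • (x + y) = a • x + a • y :=
  ext_inner (A := A) fun z => by simp [mul_add]

theorem alg_smul_complex_smul (a : A) (c : ℂ) (x : E) : a • c • x = c • a • x :=
  ext_inner (A := A) fun z => by simp [mul_smul_comm]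

theorem alg_mul_smul (a b : A) (x : E) : (a * b) • x = a • b • x :=
  ext_inner (A := A) fun z => by simp [mul_assoc]

theorem alg_sub_smul (a b : A) (x : E) : (a - b) • x = a • x - b • x :=
  ext_inner (A := A) fun z => by simp [sub_mul]

theorem norm_alg_smul_le (a : A) (x : E) : ‖a • x‖ ≤ ‖a‖ * ‖x‖ := by
  refine le_of_sq_le_sq ?_ (by positivity)
  rw [CStarModule.norm_sq_eq A, mul_pow, CStarModule.norm_sq_eq A (x := x)]
  simp only [CStarModule.inner_op_smul_right, CStarModule.inner_op_smul_left]
  calc ‖a * (inner A x x * star a)‖ ≤ ‖a‖ * (‖inner A x x‖ * ‖star a‖) :=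
        (norm_mul_le _ _).trans (by gcongr; exact norm_mul_le _ _)
    _ = ‖a‖ ^ 2 * ‖inner A x x‖ := by rw [norm_star]; ring

variable (A E) in
/-- The action of `a : A` on a Hilbert module, as a bounded operator. -/
def algSMulCLM (a : A) : E →L[ℂ] E :=
  LinearMap.mkContinuous
    { toFun := fun x => a • x
      map_add' := alg_smul_add a
      map_smul' := fun c x => alg_smul_complex_smul a c x } ‖a‖ (norm_alg_smul_le a)

@[simp] theorem algSMulCLM_apply (a : A) (x : E) : algSMulCLM A E a x = a • x := rfl

variable (A E) in
/-- `E` is countably generated: there is a countable set whose `A`-linear span is dense. -/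
def IsCountablyGenerated : Prop :=
  ∃ s : Set E, s.Countable ∧
    Dense (Submodule.span ℂ {y : E | ∃ a : A, ∃ x ∈ s, y = a • x} : Set E)

variable (E) in
/-- The submodule of products of elements of `E` with elements of the ideal `I`
(denoted `EI` for right modules), i.e. the closed linear span of all such products. -/
def idealSubmodule (I : TwoSidedIdeal A) : Submodule ℂ E :=
  (Submodule.span ℂ {y : E | ∃ a ∈ I, ∃ x : E, y = a • x}).topologicalClosure

theorem isClosed_idealSubmodule (I : TwoSidedIdeal A) :
    IsClosed (idealSubmodule E I : Set E) :=
  Submodule.isClosed_topologicalClosure _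

theorem smul_mem_idealSubmodule {I : TwoSidedIdeal A} {a : A} (ha : a ∈ I) (x : E) :
    a • x ∈ idealSubmodule E I :=
  Submodule.le_topologicalClosure _ (Submodule.subset_span ⟨a, ha, x, rfl⟩)

/-- To map `idealSubmodule E I` into a closed subspace, it suffices to map the products there. -/
theorem map_mem_of_mem_idealSubmodule {I : TwoSidedIdeal A} {F : Type*} [NormedAddCommGroup F]
    [NormedSpace ℂ F] (T : E →L[ℂ] F) (p : AddSubgroup F) (hp : IsClosed (p : Set F))
    (h : ∀ a ∈ I, ∀ x : E, T (a • x) ∈ p) {x : E} (hx : x ∈ idealSubmodule E I) : T x ∈ p := by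
  have hsub : (Submodule.span ℂ {y : E | ∃ a ∈ I, ∃ x : E, y = a • x} : Set E) ⊆
      T ⁻¹' (p : Set F) := by
    intro y hy
    induction hy using Submodule.closure_induction with
    | zero => simp
    | add y z _ _ hy hz => simpa using add_mem hy hz
    | smul_mem c y hy =>
      obtain ⟨a, ha, x, rfl⟩ := hy
      rw [← alg_smul_complex_smul]
      exact h a ha _
  exact closure_minimal hsub (hp.preimage T.continuous) hx

theorem smul_mem_idealSubmodule' (I : TwoSidedIdeal A) (a : A) {x : E}
    (hx : x ∈ idealSubmodule E I) : a • x ∈ idealSubmodule E I :=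
  map_mem_of_mem_idealSubmodule (algSMulCLM A E a) (idealSubmodule E I).toAddSubgroup
    (isClosed_idealSubmodule I)
    (fun b hb y => by
      rw [algSMulCLM_apply, ← alg_mul_smul]
      exact smul_mem_idealSubmodule (I.mul_mem_left _ _ hb) y) hx

theorem inner_right_mem (I : TwoSidedIdeal A) [hI : IsClosed (I : Set A)] (x : E) {y : E}
    (hy : y ∈ idealSubmodule E I) : inner A x y ∈ I :=
  map_mem_of_mem_idealSubmodule (CStarModule.innerSL (A := A) x)
    { carrier := I, zero_mem' := I.zero_mem, add_mem' := I.add_mem, neg_mem' := I.neg_mem } hI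
    (fun a ha y => by
      simpa [CStarModule.innerSL_apply] using I.mul_mem_right _ _ ha) hy

theorem inner_left_mem (I : TwoSidedIdeal A) [IsClosed (I : Set A)] {x : E} (y : E)
    (hx : x ∈ idealSubmodule E I) : inner A x y ∈ I := by
  rw [← CStarModule.star_inner]
  exact star_mem_of_mem I (inner_right_mem I y hx)

/-! ### `EI` as a Hilbert `A`-module, with the operations of `E` -/

instance (I : TwoSidedIdeal A) : SMul A (idealSubmodule E I) where
  smul a x := ⟨a • (x : E), smul_mem_idealSubmodule' I a x.2⟩

instance (I : TwoSidedIdeal A) : CStarModule A (idealSubmodule E I) where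
  inner x y := inner A (x : E) (y : E)
  inner_add_right := by simp
  inner_self_nonneg := CStarModule.inner_self_nonneg
  inner_self {x} := by simp [CStarModule.inner_self]
  inner_op_smul_right {a x y} := CStarModule.inner_op_smul_right (x := (x : E)) (y := (y : E))
  inner_smul_right_complex := by simp
  star_inner x y := CStarModule.star_inner _ _
  norm_eq_sqrt_norm_inner_self x := CStarModule.norm_eq_sqrt_norm_inner_self (x : E)

/-! ### `E/EI` as a Hilbert `A/I`-module -/

instance (I : TwoSidedIdeal A) : SMul I.ringCon.Quotient (E ⧸ idealSubmodule E I) where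
  smul := Quotient.map₂ (fun (a : A) (x : E) => a • x) fun a b hab x y hxy => by
    have hab' : a - b ∈ I := (I.rel_iff a b).1 hab
    have hxy' : x - y ∈ idealSubmodule E I := (Submodule.quotientRel_def _).1 hxy
    refine (Submodule.quotientRel_def _).2 ?_
    have : a • x - b • y = (a - b) • x + b • (x - y) := by
      rw [alg_sub_smul, sub_eq_add_neg x y, alg_smul_add, ← neg_one_smul ℂ y,
        alg_smul_complex_smul, neg_one_smul]
      abel
    rw [this]
    exact add_mem (smul_mem_idealSubmodule hab' x) (smul_mem_idealSubmodule' I b hxy')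

theorem mk_smul_mk (I : TwoSidedIdeal A) (a : A) (x : E) :
    (a : I.ringCon.Quotient) • (Submodule.Quotient.mk x : E ⧸ idealSubmodule E I) =
      Submodule.Quotient.mk (a • x) := rfl

/-- The `A/I`-valued inner product of `E/EI`: `⟪x + EI, y + EI⟫ = ⟪x, y⟫ + I`. -/
instance (I : TwoSidedIdeal A) [IsClosed (I : Set A)] :
    Inner I.ringCon.Quotient (E ⧸ idealSubmodule E I) where
  inner := Quotient.map₂ (fun (x y : E) => inner A x y) fun x x' hx y y' hy => by
    have hx' : x - x' ∈ idealSubmodule E I := (Submodule.quotientRel_def _).1 hx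
    have hy' : y - y' ∈ idealSubmodule E I := (Submodule.quotientRel_def _).1 hy
    refine (I.rel_iff _ _).2 ?_
    have : inner A x y - inner A x' y' = inner A (x - x') y + inner A x' (y - y') := by
      simp
    rw [this]
    exact add_mem (inner_left_mem I y hx') (inner_right_mem I x' hy')

theorem inner_mk_mk (I : TwoSidedIdeal A) [IsClosed (I : Set A)] (x y : E) :
    inner I.ringCon.Quotient (Submodule.Quotient.mk x : E ⧸ idealSubmodule E I)
      (Submodule.Quotient.mk y) = ((inner A x y : A) : I.ringCon.Quotient) := rfl

end Basic

/-- Isomorphisms (unitaries) of Hilbert modules over an algebra `B`: bijective linear maps that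
respect the action of `B` and the `B`-valued inner products. -/
structure Iso (B X Y : Type*) [AddCommGroup X] [Module ℂ X] [SMul B X] [Inner B X]
    [AddCommGroup Y] [Module ℂ Y] [SMul B Y] [Inner B Y] extends X ≃ₗ[ℂ] Y where
  map_alg_smul' : ∀ (b : B) (x : X), toFun (b • x) = b • toFun x
  inner_map_map' : ∀ x y : X, inner B (toFun x) (toFun y) = inner B x y

instance (B X Y : Type*) [AddCommGroup X] [Module ℂ X] [SMul B X] [Inner B X]
    [AddCommGroup Y] [Module ℂ Y] [SMul B Y] [Inner B Y] :
    CoeFun (Iso B X Y) fun _ => X → Y where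
  coe f := f.toLinearEquiv

section Operators

variable (A : Type*) [NonUnitalCStarAlgebra A] [PartialOrder A] [StarOrderedRing A]
  {E : Type*} [NormedAddCommGroup E] [NormedSpace ℂ E] [SMul A E] [CStarModule A E]
  {F : Type*} [NormedAddCommGroup F] [NormedSpace ℂ F] [SMul A F] [CStarModule A F]

/-- `T : E → F` is adjointable with adjoint `S`. -/
def IsAdjoint (T : E →L[ℂ] F) (S : F →L[ℂ] E) : Prop :=
  ∀ (x : E) (y : F), inner A (T x) y = inner A x (S y)

/-- `R` is the positive square root of `T` among the adjointable operators on `E`. -/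
def IsPositiveSqrt (R T : E →L[ℂ] E) : Prop :=
  IsAdjoint A R R ∧ (∀ x : E, 0 ≤ inner A x (R x)) ∧ R ∘L R = T

end Operators

/-- The element `(x, y)` of the Hilbert module direct sum `E ⊕ F`. -/
def pair (A : Type*) {E F : Type*} (x : E) (y : F) : C⋆ᵐᵒᵈ(A, E × F) :=
  (WithCStarModule.equiv A (E × F)).symm (x, y)

end HilbertModule

end

open HilbertModule WithCStarModule

noncomputable section

namespace HilbertModule

open Filter Topology CStarModule

/-! ### Adjointable operators -/

section Adjointable

variable {A : Type*} [NonUnitalCStarAlgebra A] [PartialOrder A]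
  {E : Type*} [NormedAddCommGroup E] [NormedSpace ℂ E] [SMul A E] [CStarModule A E]
  {F : Type*} [NormedAddCommGroup F] [NormedSpace ℂ F] [SMul A F] [CStarModule A F]
  {G : Type*} [NormedAddCommGroup G] [NormedSpace ℂ G] [SMul A G] [CStarModule A G]

theorem tendsto_inner [StarOrderedRing A] {α : Type*} {l : Filter α} {f g : α → E} {x y : E}
    (hf : Tendsto f l (𝓝 x)) (hg : Tendsto g l (𝓝 y)) :
    Tendsto (fun i => inner A (f i) (g i)) l (𝓝 (inner A x y)) :=
  (continuous_inner (A := A) (E := E)).continuousAt.tendsto.comp (hf.prodMk_nhds hg)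

namespace IsAdjoint

variable {T T₁ T₂ : E →L[ℂ] F} {S S₁ S₂ : F →L[ℂ] E}

theorem symm (h : IsAdjoint A T S) : IsAdjoint A S T := fun x y => by
  rw [← star_inner, ← h y x, star_inner]

theorem add (h₁ : IsAdjoint A T₁ S₁) (h₂ : IsAdjoint A T₂ S₂) :
    IsAdjoint A (T₁ + T₂) (S₁ + S₂) := fun x y => by
  simp [h₁ x y, h₂ x y]

theorem sub (h₁ : IsAdjoint A T₁ S₁) (h₂ : IsAdjoint A T₂ S₂) :
    IsAdjoint A (T₁ - T₂) (S₁ - S₂) := fun x y => by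
  simp [h₁ x y, h₂ x y]

theorem smul (h : IsAdjoint A T S) (c : ℂ) : IsAdjoint A (c • T) (star c • S) := fun x y => by
  simp [h x y]

theorem comp {T' : F →L[ℂ] G} {S' : G →L[ℂ] F} (h' : IsAdjoint A T' S') (h : IsAdjoint A T S) :
    IsAdjoint A (T' ∘L T) (S ∘L S') := fun x y => by
  simp [h' (T x) y, h x (S' y)]

theorem id : IsAdjoint A (ContinuousLinearMap.id ℂ E) (ContinuousLinearMap.id ℂ E) :=
  fun _ _ => rfl

variable [StarOrderedRing A]

theorem unique (h₁ : IsAdjoint A T S₁) (h₂ : IsAdjoint A T S₂) : S₁ = S₂ := by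
  ext y
  exact ext_inner (A := A) fun z => by rw [← h₁ z y, h₂ z y]

theorem map_alg_smul (h : IsAdjoint A T S) (a : A) (x : E) : T (a • x) = a • T x :=
  ext_inner (A := A) fun z => by
    rw [inner_op_smul_right, ← h.symm, ← h.symm, inner_op_smul_right]

theorem norm_apply_sq_le (h : IsAdjoint A T S) (x : E) : ‖T x‖ ^ 2 ≤ ‖S (T x)‖ * ‖x‖ := by
  rw [norm_sq_eq A, h, mul_comm]
  exact norm_inner_le E

theorem norm_le (h : IsAdjoint A T S) : ‖T‖ ≤ ‖S‖ := by
  refine T.opNorm_le_bound (norm_nonneg _) fun x => ?_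
  rcases (norm_nonneg (T x)).eq_or_lt with h0 | h0
  · rw [← h0]; positivity
  · refine le_of_mul_le_mul_right ?_ h0
    calc ‖T x‖ * ‖T x‖ = ‖T x‖ ^ 2 := (sq _).symm
      _ ≤ ‖S (T x)‖ * ‖x‖ := h.norm_apply_sq_le x
      _ ≤ ‖S‖ * ‖T x‖ * ‖x‖ := by gcongr; exact S.le_opNorm _
      _ = ‖S‖ * ‖x‖ * ‖T x‖ := by ring

theorem norm_eq (h : IsAdjoint A T S) : ‖T‖ = ‖S‖ := le_antisymm h.norm_le h.symm.norm_le

theorem of_tendsto {α : Type*} {l : Filter α} [l.NeBot] {T' : α → E →L[ℂ] F} {S' : α → F →L[ℂ] E}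
    (h : ∀ i, IsAdjoint A (T' i) (S' i)) (hT : Tendsto T' l (𝓝 T)) (hS : Tendsto S' l (𝓝 S)) :
    IsAdjoint A T S := fun x y => by
  have hTx : Tendsto (fun i => T' i x) l (𝓝 (T x)) :=
    ((ContinuousLinearMap.apply ℂ F x).continuous.tendsto T).comp hT
  have hSy : Tendsto (fun i => S' i y) l (𝓝 (S y)) :=
    ((ContinuousLinearMap.apply ℂ E y).continuous.tendsto S).comp hS
  refine tendsto_nhds_unique (tendsto_inner hTx tendsto_const_nhds) ?_
  simp only [h _ x y]
  exact tendsto_inner tendsto_const_nhds hSy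

end IsAdjoint

variable (A E) in
/-- The algebra of adjointable operators on the Hilbert module `E`.  For complete `E` it is a
C⋆-algebra, which makes the continuous functional calculus available. -/
def adjointable : Subalgebra ℂ (E →L[ℂ] E) where
  carrier := {T | ∃ S, IsAdjoint A T S}
  mul_mem' := fun ⟨_, h₁⟩ ⟨_, h₂⟩ => ⟨_, h₁.comp h₂⟩
  add_mem' := fun ⟨_, h₁⟩ ⟨_, h₂⟩ => ⟨_, h₁.add h₂⟩
  algebraMap_mem' c := ⟨star c • ContinuousLinearMap.id ℂ E, by
    rw [Algebra.algebraMap_eq_smul_one]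
    exact IsAdjoint.id.smul c⟩

namespace adjointable

instance : Star (adjointable A E) where
  star a := ⟨a.2.choose, a, a.2.choose_spec.symm⟩

theorem isAdjoint_star (a : adjointable A E) :
    IsAdjoint A (a : E →L[ℂ] E) (star a : adjointable A E) :=
  a.2.choose_spec

variable [StarOrderedRing A]

theorem star_eq {a b : adjointable A E} (h : IsAdjoint A (a : E →L[ℂ] E) b) : star a = b :=
  Subtype.ext ((isAdjoint_star a).unique h)

instance : StarRing (adjointable A E) where
  star_involutive a := star_eq (isAdjoint_star a).symm
  star_mul a b := star_eq ((isAdjoint_star a).comp (isAdjoint_star b))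
  star_add a b := star_eq ((isAdjoint_star a).add (isAdjoint_star b))

instance : StarModule ℂ (adjointable A E) where
  star_smul c a := star_eq ((isAdjoint_star a).smul c)

instance : CStarRing (adjointable A E) where
  norm_mul_self_le a := by
    have h : ‖(a : E →L[ℂ] E)‖ ≤ √‖star a * a‖ := by
      refine ContinuousLinearMap.opNorm_le_bound _ (Real.sqrt_nonneg _) fun x => ?_
      refine le_of_sq_le_sq ?_ (by positivity)
      rw [mul_pow, Real.sq_sqrt (norm_nonneg (star a * a))]
      calc ‖(a : E →L[ℂ] E) x‖ ^ 2 ≤ ‖(star a * a : adjointable A E).1 x‖ * ‖x‖ :=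
            (isAdjoint_star a).norm_apply_sq_le x
        _ ≤ ‖star a * a‖ * ‖x‖ * ‖x‖ := by
            gcongr
            exact ContinuousLinearMap.le_opNorm _ _
        _ = ‖star a * a‖ * ‖x‖ ^ 2 := by ring
    calc ‖a‖ * ‖a‖ ≤ √‖star a * a‖ * √‖star a * a‖ := by gcongr <;> exact h
      _ = ‖star a * a‖ := Real.mul_self_sqrt (norm_nonneg _)

theorem isSelfAdjoint_iff {a : adjointable A E} :
    IsSelfAdjoint a ↔ IsAdjoint A (a : E →L[ℂ] E) a :=
  ⟨fun h => by simpa only [h.star_eq] using isAdjoint_star a, star_eq⟩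

variable [CompleteSpace E]

theorem isClosed : IsClosed (adjointable A E : Set (E →L[ℂ] E)) := by
  refine IsSeqClosed.isClosed fun T T₀ hT hlim => ?_
  choose S hS using hT
  have hcau : CauchySeq S := by
    refine Metric.cauchySeq_iff.2 fun ε hε => ?_
    obtain ⟨N, hN⟩ := Metric.cauchySeq_iff.1 hlim.cauchySeq ε hε
    refine ⟨N, fun m hm n hn => ?_⟩
    rw [dist_eq_norm, ← ((hS m).sub (hS n)).norm_eq, ← dist_eq_norm]
    exact hN m hm n hn
  obtain ⟨S₀, hS₀⟩ := cauchySeq_tendsto_of_complete hcau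
  exact ⟨S₀, .of_tendsto hS hlim hS₀⟩

instance : CompleteSpace (adjointable A E) := isClosed.completeSpace_coe

instance : CStarAlgebra (adjointable A E) where

instance : PartialOrder (adjointable A E) := CStarAlgebra.spectralOrder _

instance : StarOrderedRing (adjointable A E) := CStarAlgebra.spectralOrderedRing _

theorem inner_nonneg {a : adjointable A E} (ha : 0 ≤ a) (x : E) : 0 ≤ inner A x (a.1 x) := by
  obtain ⟨b, rfl⟩ := CStarAlgebra.nonneg_iff_eq_star_mul_self.1 ha
  calc 0 ≤ inner A (b.1 x) (b.1 x) := inner_self_nonneg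
    _ = inner A x ((star b * b).1 x) := isAdjoint_star b x _

theorem eq_zero_of_inner_eq_zero {a : adjointable A E} (ha : 0 ≤ a)
    (h : ∀ x : E, inner A x (a.1 x) = 0) : a = 0 := by
  obtain ⟨b, rfl⟩ := CStarAlgebra.nonneg_iff_eq_star_mul_self.1 ha
  have hb : b = 0 := Subtype.ext <| ContinuousLinearMap.ext fun x =>
    inner_self.1 ((isAdjoint_star b x _).trans (h x))
  simp [hb]

theorem nonneg_iff {a : adjointable A E} (ha : IsSelfAdjoint a) :
    0 ≤ a ↔ ∀ x : E, 0 ≤ inner A x (a.1 x) := by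
  refine ⟨inner_nonneg, fun h => ?_⟩
  have hneg : star a⁻ = a⁻ := (CFC.negPart_nonneg a).isSelfAdjoint.star_eq
  have hconj : a⁻ * a * a⁻ = -(a⁻ * a⁻ * a⁻) := by
    nth_rw 2 [← CFC.posPart_sub_negPart a]
    rw [mul_sub, CFC.negPart_mul_posPart]
    noncomm_ring
  have hcube : 0 ≤ a⁻ * a⁻ * a⁻ := by
    simpa only [hneg] using star_right_conjugate_nonneg (CFC.negPart_nonneg a) a⁻
  -- `⟪x, (a⁻)³ x⟫` is nonnegative, and it is the negative of `⟪a⁻ x, a (a⁻ x)⟫`.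
  have hzero : a⁻ * a⁻ * a⁻ = 0 := eq_zero_of_inner_eq_zero hcube fun x => by
    refine le_antisymm (neg_nonneg.1 ?_) (inner_nonneg hcube x)
    calc 0 ≤ inner A (a⁻.1 x) (a.1 (a⁻.1 x)) := h _
      _ = inner A x ((a⁻ * a * a⁻).1 x) := by
        rw [isAdjoint_star a⁻ x, hneg]
        rfl
      _ = -inner A x ((a⁻ * a⁻ * a⁻).1 x) := by
        rw [hconj, ← CStarModule.inner_neg_right]
        rfl
  have hsq : a⁻ * a⁻ = 0 := by
    refine (CStarRing.star_mul_self_eq_zero_iff _).1 ?_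
    rw [star_mul, hneg, ← mul_assoc, hzero, zero_mul]
  refine (CFC.negPart_eq_zero_iff a).1 ((CStarRing.star_mul_self_eq_zero_iff _).1 ?_)
  rw [hneg, hsq]

theorem le_iff {a b : adjointable A E} (ha : IsSelfAdjoint a) (hb : IsSelfAdjoint b) :
    a ≤ b ↔ ∀ x : E, inner A x (a.1 x) ≤ inner A x (b.1 x) := by
  rw [← sub_nonneg, nonneg_iff (hb.sub ha)]
  refine forall_congr' fun x => ?_
  rw [← sub_nonneg (b := inner A x (a.1 x)), ← CStarModule.inner_sub_right]
  rfl

end adjointable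

end Adjointable

/-! ### Rank-one operators -/

section RankOne

variable {A : Type*} [NonUnitalCStarAlgebra A] [PartialOrder A] [StarOrderedRing A]
  {E : Type*} [NormedAddCommGroup E] [NormedSpace ℂ E] [SMul A E] [CStarModule A E]
  {F : Type*} [NormedAddCommGroup F] [NormedSpace ℂ F] [SMul A F] [CStarModule A F]

theorem alg_add_smul (a b : A) (x : E) : (a + b) • x = a • x + b • x :=
  ext_inner (A := A) fun z => by simp [add_mul]

theorem complex_smul_alg_smul (c : ℂ) (a : A) (x : E) : (c • a) • x = c • a • x :=
  ext_inner (A := A) fun z => by simp [smul_mul_assoc]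

variable (A) in
/-- The rank-one operator `θ_{y,x} : z ↦ ⟪x, z⟫ • y`. -/
def rankOne (x : E) (y : F) : E →L[ℂ] F :=
  LinearMap.mkContinuous
    { toFun := fun z => inner A x z • y
      map_add' := fun z w => by rw [CStarModule.inner_add_right, alg_add_smul]
      map_smul' := fun c z => by
        rw [inner_smul_right_complex, complex_smul_alg_smul, RingHom.id_apply] } (‖x‖ * ‖y‖)
    fun z => calc
      ‖inner A x z • y‖ ≤ ‖inner A x z‖ * ‖y‖ := norm_alg_smul_le _ _
      _ ≤ ‖x‖ * ‖z‖ * ‖y‖ := by gcongr; exact norm_inner_le E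
      _ = ‖x‖ * ‖y‖ * ‖z‖ := by ring

theorem rankOne_apply (x z : E) (y : F) : rankOne A x y z = inner A x z • y := rfl

theorem norm_rankOne_le (x : E) (y : F) : ‖rankOne A x y‖ ≤ ‖x‖ * ‖y‖ :=
  LinearMap.mkContinuous_norm_le _ (by positivity) _

theorem isAdjoint_rankOne (x : E) (y : F) : IsAdjoint A (rankOne A x y) (rankOne A y x) :=
  fun z w => by simp [rankOne_apply]

variable (A) in
/-- The positive rank-one operator `θ_{x,x}`. -/
def rankOneSelf (x : E) : adjointable A E := ⟨rankOne A x x, _, isAdjoint_rankOne x x⟩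

theorem rankOneSelf_apply (x z : E) : (rankOneSelf A x).1 z = inner A x z • x := rfl

theorem inner_rankOneSelf_apply (x z : E) :
    inner A z ((rankOneSelf A x).1 z) = inner A x z * star (inner A x z) := by
  rw [rankOneSelf_apply, inner_op_smul_right, star_inner]

theorem isSelfAdjoint_rankOneSelf (x : E) : IsSelfAdjoint (rankOneSelf A x) :=
  adjointable.isSelfAdjoint_iff.2 (isAdjoint_rankOne x x)

theorem norm_rankOneSelf (x : E) : ‖rankOneSelf A x‖ = ‖x‖ ^ 2 := by
  refine le_antisymm ((norm_rankOne_le x x).trans_eq (sq _).symm) ?_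
  rcases (norm_nonneg x).eq_or_lt with hx | hx
  · rw [← hx, zero_pow two_ne_zero]
    exact norm_nonneg (rankOneSelf A x)
  have hinner : ‖inner A x ((rankOneSelf A x).1 x)‖ = ‖x‖ ^ 2 * ‖x‖ ^ 2 := by
    rw [inner_rankOneSelf_apply, CStarRing.norm_self_mul_star, norm_sq_eq A]
  refine le_of_mul_le_mul_right ?_ (pow_pos hx 2)
  calc ‖x‖ ^ 2 * ‖x‖ ^ 2 = ‖inner A x ((rankOneSelf A x).1 x)‖ := hinner.symm
    _ ≤ ‖x‖ * ‖(rankOneSelf A x).1 x‖ := norm_inner_le E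
    _ ≤ ‖x‖ * (‖rankOneSelf A x‖ * ‖x‖) := by
        gcongr
        exact ContinuousLinearMap.le_opNorm _ _
    _ = ‖rankOneSelf A x‖ * ‖x‖ ^ 2 := by ring

theorem mul_rankOneSelf_mul_star (a : adjointable A E) (x : E) :
    a * rankOneSelf A x * star a = rankOneSelf A (a.1 x) := by
  ext z
  change a.1 (inner A x ((star a).1 z) • x) = inner A (a.1 x) z • a.1 x
  rw [(adjointable.isAdjoint_star a).map_alg_smul, adjointable.isAdjoint_star a x z]

theorem rankOneSelf_nonneg [CompleteSpace E] (x : E) : 0 ≤ rankOneSelf A x :=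
  (adjointable.nonneg_iff (isSelfAdjoint_rankOneSelf x)).2 fun z => by
    rw [inner_rankOneSelf_apply]
    exact mul_star_self_nonneg _

end RankOne

/-! ### Cutoff functions -/

/-- The functions `cutoff n` increase to the indicator function of `t ≠ 0`; applied to a positive
operator, they form an approximate unit for its range. -/
def cutoff (n : ℕ) (t : ℝ) : ℝ := n * t ^ 2 / (1 + n * t ^ 2)

/-- For `0 ≤ t` the increment `cutoff (n + 1) t - cutoff n t` is `t * cutoffRoot n t ^ 2`. -/
def cutoffRoot (n : ℕ) (t : ℝ) : ℝ := √(t / ((1 + n * t ^ 2) * (1 + (n + 1) * t ^ 2)))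

theorem continuous_cutoff (n : ℕ) : Continuous (cutoff n) :=
  Continuous.div (by fun_prop) (by fun_prop) fun t => by positivity

theorem continuous_cutoffRoot (n : ℕ) : Continuous (cutoffRoot n) :=
  (Continuous.div (by fun_prop) (by fun_prop) fun t => by positivity).sqrt

theorem cutoff_zero : cutoff 0 = 0 := by
  ext t
  simp [cutoff]

theorem cutoff_nonneg (n : ℕ) (t : ℝ) : 0 ≤ cutoff n t := by
  rw [cutoff]
  positivity

theorem cutoff_le_one (n : ℕ) (t : ℝ) : cutoff n t ≤ 1 := by
  rw [cutoff, div_le_one (by positivity)]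
  linarith

theorem cutoffRoot_mul_mul (n : ℕ) {t : ℝ} (ht : 0 ≤ t) :
    cutoffRoot n t * t * cutoffRoot n t = cutoff (n + 1) t - cutoff n t := by
  rw [mul_right_comm, cutoffRoot, Real.mul_self_sqrt (by positivity), cutoff, cutoff]
  push_cast
  field_simp
  ring

theorem mul_one_sub_cutoff_sq_le {n : ℕ} (hn : 0 < n) {t : ℝ} (ht : 0 ≤ t) :
    (1 - cutoff n t) * t * (1 - cutoff n t) ≤ (√n)⁻¹ := by
  have hsub : 1 - cutoff n t = (1 + n * t ^ 2)⁻¹ := by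
    rw [cutoff]
    field_simp
    ring
  have hle : t * √n ≤ 1 + n * t ^ 2 := by
    nlinarith [sq_nonneg (t * √n - 1), Real.sq_sqrt (Nat.cast_nonneg (α := ℝ) n)]
  calc (1 - cutoff n t) * t * (1 - cutoff n t)
      ≤ (1 - cutoff n t) * t * 1 := by
        gcongr
        · exact mul_nonneg (sub_nonneg.2 (cutoff_le_one n t)) ht
        · linarith [cutoff_nonneg n t]
    _ = t / (1 + n * t ^ 2) := by rw [hsub, mul_one, inv_mul_eq_div]
    _ ≤ (√n)⁻¹ := by
        rw [inv_eq_one_div, div_le_div_iff₀ (by positivity) (by positivity), one_mul]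
        exact hle

section cfc

variable {B : Type*} [CStarAlgebra B] {p : B}

theorem cfc_cutoff_zero : cfc (cutoff 0) p = 0 := by
  rw [cutoff_zero]
  exact cfc_zero ℝ p

theorem norm_cfc_cutoff_le (n : ℕ) : ‖cfc (cutoff n) p‖ ≤ 1 :=
  norm_cfc_le zero_le_one fun t _ => by
    rw [Real.norm_of_nonneg (cutoff_nonneg n t)]
    exact cutoff_le_one n t

theorem cfc_mul_self_mul_cfc (hp : IsSelfAdjoint p) {f : ℝ → ℝ} (hf : Continuous f) :
    cfc f p * p * cfc f p = cfc (fun t => f t * t * f t) p := by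
  rw [cfc_mul (fun t => f t * t) f p (by fun_prop) (by fun_prop),
    cfc_mul f (fun t => t) p (by fun_prop) (by fun_prop), cfc_id' ℝ p]

theorem one_sub_cfc (hp : IsSelfAdjoint p) {f : ℝ → ℝ} (hf : Continuous f) :
    1 - cfc f p = cfc (fun t => 1 - f t) p := by
  rw [cfc_sub _ _ p continuousOn_const (by fun_prop), cfc_const_one ℝ p]

variable [PartialOrder B] [StarOrderedRing B]

theorem cfc_cutoffRoot_mul_mul (hp : 0 ≤ p) (n : ℕ) :
    cfc (cutoffRoot n) p * p * cfc (cutoffRoot n) p =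
      cfc (cutoff (n + 1)) p - cfc (cutoff n) p := by
  rw [cfc_mul_self_mul_cfc hp.isSelfAdjoint (continuous_cutoffRoot n),
    ← cfc_sub _ _ p (continuous_cutoff _).continuousOn (continuous_cutoff _).continuousOn]
  exact cfc_congr fun t ht => cutoffRoot_mul_mul n (spectrum_nonneg_of_nonneg hp ht)

theorem norm_one_sub_cfc_cutoff_mul_mul_le (hp : 0 ≤ p) {n : ℕ} (hn : 0 < n) :
    ‖(1 - cfc (cutoff n) p) * p * (1 - cfc (cutoff n) p)‖ ≤ (√n)⁻¹ := by
  rw [one_sub_cfc hp.isSelfAdjoint (continuous_cutoff n),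
    cfc_mul_self_mul_cfc hp.isSelfAdjoint (by have := continuous_cutoff n; fun_prop)]
  refine norm_cfc_le (by positivity) fun t ht => ?_
  have ht0 : 0 ≤ t := spectrum_nonneg_of_nonneg hp ht
  have hc : 0 ≤ 1 - cutoff n t := sub_nonneg.2 (cutoff_le_one n t)
  rw [Real.norm_of_nonneg (by positivity)]
  exact mul_one_sub_cutoff_sq_le hn ht0

section Module

variable {A : Type*} [NonUnitalCStarAlgebra A] [PartialOrder A] [StarOrderedRing A]
  {E : Type*} [NormedAddCommGroup E] [NormedSpace ℂ E] [SMul A E] [CStarModule A E]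
  [CompleteSpace E]

theorem norm_sub_cfc_cutoff_sq_le {p : adjointable A E} {x : E} (h : rankOneSelf A x ≤ p) {n : ℕ}
    (hn : 0 < n) : ‖x - (cfc (cutoff n) p).1 x‖ ^ 2 ≤ (√n)⁻¹ := by
  set d : adjointable A E := 1 - cfc (cutoff n) p
  have hd : star d = d := ((IsSelfAdjoint.one _).sub (cfc_predicate _ p)).star_eq
  calc ‖x - (cfc (cutoff n) p).1 x‖ ^ 2 = ‖d * rankOneSelf A x * d‖ := by
        have hconj := mul_rankOneSelf_mul_star d x
        rw [hd] at hconj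
        rw [hconj, norm_rankOneSelf]
        rfl
    _ ≤ ‖d * p * d‖ := by
        refine CStarAlgebra.norm_le_norm_of_nonneg_of_le ?_ ?_
        · simpa only [hd] using star_right_conjugate_nonneg (rankOneSelf_nonneg x) d
        · simpa only [hd] using star_right_conjugate_le_conjugate h d
    _ ≤ (√n)⁻¹ := norm_one_sub_cfc_cutoff_mul_mul_le ((rankOneSelf_nonneg x).trans h) hn

theorem tendsto_cfc_cutoff_of_rankOneSelf_le {p : adjointable A E} {x : E}
    (h : rankOneSelf A x ≤ p) :
    Tendsto (fun n => (cfc (cutoff n) p).1 x) atTop (𝓝 x) := by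
  have hlim : Tendsto (fun n : ℕ => (√n)⁻¹) atTop (𝓝 0) :=
    tendsto_inv_atTop_zero.comp (Real.tendsto_sqrt_atTop.comp tendsto_natCast_atTop_atTop)
  have hsq : Tendsto (fun n => ‖x - (cfc (cutoff n) p).1 x‖ ^ 2) atTop (𝓝 0) :=
    squeeze_zero' (.of_forall fun n => sq_nonneg _)
      (eventually_atTop.2 ⟨1, fun n hn => norm_sub_cfc_cutoff_sq_le h hn⟩) hlim
  rw [tendsto_iff_norm_sub_tendsto_zero]
  simpa [Real.sqrt_sq, norm_sub_rev] using hsq.sqrt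

end Module

end cfc

/-! ### Quotients of Hilbert modules and their isomorphisms -/

section Quotient

variable {A : Type*} [NonUnitalCStarAlgebra A] [PartialOrder A] [StarOrderedRing A]
  {E : Type*} [NormedAddCommGroup E] [NormedSpace ℂ E] [SMul A E] [CStarModule A E]
  {H : Type*} [NormedAddCommGroup H] [NormedSpace ℂ H] [SMul A H] [CStarModule A H]

theorem IsAdjoint.mapsTo_idealSubmodule {T : H →L[ℂ] E} {S : E →L[ℂ] H} (h : IsAdjoint A T S)
    (I : TwoSidedIdeal A) {x : H} (hx : x ∈ idealSubmodule H I) : T x ∈ idealSubmodule E I :=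
  map_mem_of_mem_idealSubmodule T (idealSubmodule E I).toAddSubgroup (isClosed_idealSubmodule I)
    (fun a ha x => by
      rw [h.map_alg_smul]
      exact smul_mem_idealSubmodule ha _) hx

theorem mem_idealSubmodule_of_inner_self_mem [CompleteSpace E] (I : TwoSidedIdeal A) {x : E}
    (hx : inner A x x ∈ I) : x ∈ idealSubmodule E I := by
  refine (isClosed_idealSubmodule I).mem_of_tendsto
    (tendsto_cfc_cutoff_of_rankOneSelf_le (le_refl (rankOneSelf A x))) (.of_forall fun n => ?_)
  -- `cutoff n θ` is divisible by `θ`, and `θ x = ⟪x, x⟫ • x`.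
  set θ := rankOneSelf A x
  have hθ : IsSelfAdjoint θ := isSelfAdjoint_rankOneSelf x
  let f : ℝ → ℝ := fun t => n * t / (1 + n * t ^ 2)
  have hf : Continuous f := Continuous.div (by fun_prop) (by fun_prop) fun t => by positivity
  have hfactor : cfc (cutoff n) θ = cfc f θ * θ := by
    have hmul : cutoff n = fun t => f t * t := by
      ext t
      simp only [cutoff, f]
      ring
    rw [hmul, cfc_mul f (fun t => t) θ hf.continuousOn, cfc_id' ℝ θ]
  rw [hfactor]
  exact (adjointable.isAdjoint_star (cfc f θ)).mapsTo_idealSubmodule I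
    (smul_mem_idealSubmodule hx x)

variable {I : TwoSidedIdeal A} [hI : IsClosed (I : Set A)]

theorem mk_eq_mk_iff [CompleteSpace E] {x y : E} :
    (Submodule.Quotient.mk x : E ⧸ idealSubmodule E I) = Submodule.Quotient.mk y ↔
      inner A (x - y) (x - y) ∈ I := by
  rw [Submodule.Quotient.eq]
  exact ⟨fun h => inner_right_mem I _ h, mem_idealSubmodule_of_inner_self_mem I⟩

/-- The relation between `H` and `E` given by the graph of `φ : H/HI → E/EI`: `φ` maps the class
of `x` to the class of `y`. -/
def Iso.Rel (φ : Iso I.ringCon.Quotient (H ⧸ idealSubmodule H I) (E ⧸ idealSubmodule E I))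
    (x : H) (y : E) : Prop :=
  (Submodule.Quotient.mk y : E ⧸ idealSubmodule E I) = φ (Submodule.Quotient.mk x)

namespace Iso.Rel

variable {φ : Iso I.ringCon.Quotient (H ⧸ idealSubmodule H I) (E ⧸ idealSubmodule E I)}

theorem inner_sub_mem {x x' : H} {y y' : E} (h : φ.Rel x y) (h' : φ.Rel x' y') :
    inner A y y' - inner A x x' ∈ I := by
  have hmk := φ.inner_map_map' (Submodule.Quotient.mk x) (Submodule.Quotient.mk x')
  change inner I.ringCon.Quotient (φ (Submodule.Quotient.mk x)) (φ (Submodule.Quotient.mk x')) =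
    _ at hmk
  rw [← h, ← h', inner_mk_mk, inner_mk_mk] at hmk
  exact (I.rel_iff _ _).1 ((RingCon.eq _).1 hmk)

theorem exists_right (φ : Iso I.ringCon.Quotient (H ⧸ idealSubmodule H I)
    (E ⧸ idealSubmodule E I)) (x : H) : ∃ y, φ.Rel x y :=
  Submodule.Quotient.mk_surjective _ _

theorem exists_left (φ : Iso I.ringCon.Quotient (H ⧸ idealSubmodule H I)
    (E ⧸ idealSubmodule E I)) (y : E) : ∃ x, φ.Rel x y := by
  obtain ⟨z, hz⟩ := φ.toLinearEquiv.surjective (Submodule.Quotient.mk y)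
  obtain ⟨x, rfl⟩ := Submodule.Quotient.mk_surjective _ z
  exact ⟨x, hz.symm⟩

theorem zero : φ.Rel 0 0 := (map_zero φ.toLinearEquiv).symm

theorem add {x x' : H} {y y' : E} (h : φ.Rel x y) (h' : φ.Rel x' y') :
    φ.Rel (x + x') (y + y') := by
  unfold Iso.Rel at *
  rw [Submodule.Quotient.mk_add, Submodule.Quotient.mk_add, h, h']
  exact (map_add φ.toLinearEquiv _ _).symm

theorem smul (c : ℂ) {x : H} {y : E} (h : φ.Rel x y) : φ.Rel (c • x) (c • y) := by
  unfold Iso.Rel at *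
  rw [Submodule.Quotient.mk_smul, Submodule.Quotient.mk_smul, h]
  exact (map_smul φ.toLinearEquiv _ _).symm

theorem alg_smul {a b : A} (hab : a - b ∈ I) {x : H} {y : E} (h : φ.Rel x y) :
    φ.Rel (a • x) (b • y) := by
  have hmk : (a : I.ringCon.Quotient) = b := (RingCon.eq _).2 ((I.rel_iff _ _).2 hab)
  unfold Iso.Rel at *
  rw [← mk_smul_mk, ← mk_smul_mk, h, hmk]
  exact (φ.map_alg_smul' _ _).symm

theorem sum {ι : Type*} (s : Finset ι) {x : ι → H} {y : ι → E} (h : ∀ i, φ.Rel (x i) (y i)) :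
    φ.Rel (∑ i ∈ s, x i) (∑ i ∈ s, y i) := by
  classical
  induction s using Finset.induction_on with
  | empty => simpa using zero
  | insert i s hi ih => simpa [Finset.sum_insert hi] using (h i).add ih

theorem sub_mem_right {x : H} {y z : E} (h : φ.Rel x y) (hz : z ∈ idealSubmodule E I) :
    φ.Rel x (y - z) :=
  ((Submodule.Quotient.eq _).2 (by rwa [sub_sub_cancel_left, neg_mem_iff])).trans h

variable [CompleteSpace E]

theorem of_inner {x : H} {y : E}
    (h : ∀ x' y', φ.Rel x' y' → inner A y y' - inner A x x' ∈ I) : φ.Rel x y := by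
  obtain ⟨z, hz⟩ := exists_right φ x
  rw [Iso.Rel, ← (show _ = _ from hz), mk_eq_mk_iff]
  obtain ⟨w, hw⟩ := exists_left φ (y - z)
  have hmem := sub_mem (h w _ hw) (hz.inner_sub_mem hw)
  simpa only [sub_sub_sub_cancel_right, ← CStarModule.inner_sub_left] using hmem

theorem of_tendsto {α : Type*} {l : Filter α} [l.NeBot] {f : α → H} {g : α → E} {x : H} {y : E}
    (h : ∀ i, φ.Rel (f i) (g i)) (hf : Tendsto f l (𝓝 x)) (hg : Tendsto g l (𝓝 y)) :
    φ.Rel x y :=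
  of_inner fun x' y' h' => hI.mem_of_tendsto
    ((tendsto_inner hg (tendsto_const_nhds (x := y'))).sub
      (tendsto_inner hf (tendsto_const_nhds (x := x'))))
    (Eventually.of_forall fun i => (h i).inner_sub_mem h')

theorem adjoint {ψ : H →L[ℂ] E} {ψ' : E →L[ℂ] H} (h : IsAdjoint A ψ ψ')
    (hψ : ∀ x, φ.Rel x (ψ x)) (y : E) : φ.Rel (ψ' y) y :=
  .of_inner fun x' y' h' => by
    rw [h.symm, ← CStarModule.inner_sub_right]
    exact inner_right_mem I y ((Submodule.Quotient.eq _).1 (h'.trans (hψ x').symm))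

end Iso.Rel

/-- The pairs of adjointable operators on `H` and `E` that induce operators on `H/HI` and `E/EI`
intertwined by `φ`. -/
def Iso.intertwined [CompleteSpace E]
    (φ : Iso I.ringCon.Quotient (H ⧸ idealSubmodule H I) (E ⧸ idealSubmodule E I)) :
    StarSubalgebra ℂ (adjointable A H × adjointable A E) where
  carrier := {T | ∀ x y, φ.Rel x y → φ.Rel (T.1.1 x) (T.2.1 y)}
  mul_mem' h₁ h₂ x y h := h₁ _ _ (h₂ _ _ h)
  add_mem' h₁ h₂ x y h := (h₁ _ _ h).add (h₂ _ _ h)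
  algebraMap_mem' c x y h := by
    rw [Algebra.algebraMap_eq_smul_one]
    exact h.smul c
  star_mem' {T} hT x y h := .of_inner fun x' y' h' => by
    have hH : inner A ((star T).1.1 x) x' = inner A x (T.1.1 x') :=
      (adjointable.isAdjoint_star T.1).symm x x'
    have hE : inner A ((star T).2.1 y) y' = inner A y (T.2.1 y') :=
      (adjointable.isAdjoint_star T.2).symm y y'
    rw [hH, hE]
    exact h.inner_sub_mem (hT _ _ h')

namespace Iso

variable [CompleteSpace E]
  (φ : Iso I.ringCon.Quotient (H ⧸ idealSubmodule H I) (E ⧸ idealSubmodule E I))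

theorem isClosed_intertwined :
    IsClosed (φ.intertwined : Set (adjointable A H × adjointable A E)) := by
  refine IsSeqClosed.isClosed fun T T₀ hT hlim x y h =>
    .of_tendsto (fun n => hT n x y h) (l := atTop) ?_ ?_
  · exact (((ContinuousLinearMap.apply ℂ H x).continuous.comp
      (continuous_subtype_val.comp continuous_fst)).tendsto T₀).comp hlim
  · exact (((ContinuousLinearMap.apply ℂ E y).continuous.comp
      (continuous_subtype_val.comp continuous_snd)).tendsto T₀).comp hlim

variable {φ}

theorem Rel.rankOneSelf_mem_intertwined {x : H} {y : E} (h : φ.Rel x y) :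
    (rankOneSelf A x, rankOneSelf A y) ∈ φ.intertwined := fun z w hzw => by
  refine h.alg_smul ?_
  rw [← neg_sub]
  exact I.neg_mem (h.inner_sub_mem hzw)

theorem hasSum_mem_intertwined {ι : Type*} {a : ι → adjointable A H} {b : ι → adjointable A E}
    {p : adjointable A H} {q : adjointable A E} (hp : HasSum a p) (hq : HasSum b q)
    (h : ∀ i, (a i, b i) ∈ φ.intertwined) : (p, q) ∈ φ.intertwined :=
  φ.isClosed_intertwined.mem_of_tendsto (hp.prodMk hq) (.of_forall fun _ => sum_mem fun i _ => h i)

end Iso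

end Quotient

section cfc

theorem exists_mem_map_eq_cfc {B C D : Type*} [CStarAlgebra B] [CStarAlgebra C] [CStarAlgebra D]
    {π₁ : D →⋆ₐ[ℂ] B} {π₂ : D →⋆ₐ[ℂ] C} (h₁ : Continuous π₁) (h₂ : Continuous π₂)
    {K : StarSubalgebra ℂ D} (hK : IsClosed (K : Set D)) {f : ℝ → ℝ} (hf : Continuous f) {d : D}
    (hd : IsSelfAdjoint d) (h : d ∈ K) : ∃ d' ∈ K, π₁ d' = cfc f (π₁ d) ∧ π₂ d' = cfc f (π₂ d) :=
  ⟨cfc f d, cfc_mem (hs := hK) f h,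
    StarAlgHomClass.map_cfc (R := ℝ) (S := ℂ) π₁ f d hf.continuousOn h₁ hd (hd.map π₁),
    StarAlgHomClass.map_cfc (R := ℝ) (S := ℂ) π₂ f d hf.continuousOn h₂ hd (hd.map π₂)⟩

theorem cfc_prod_mem {B C : Type*} [CStarAlgebra B] [CStarAlgebra C] {K : StarSubalgebra ℂ (B × C)}
    (hK : IsClosed (K : Set (B × C))) {f : ℝ → ℝ} (hf : Continuous f) {b : B} {c : C}
    (hb : IsSelfAdjoint b) (hc : IsSelfAdjoint c) (h : (b, c) ∈ K) : (cfc f b, cfc f c) ∈ K := by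
  have hbc : IsSelfAdjoint (b, c) := Prod.ext hb hc
  obtain ⟨d, hd, hdb, hdc⟩ := exists_mem_map_eq_cfc (π₁ := StarAlgHom.fst ℂ B C)
    (π₂ := StarAlgHom.snd ℂ B C) continuous_fst continuous_snd hK hf hbc h
  exact (Prod.ext hdb hdc : d = (cfc f b, cfc f c)) ▸ hd

end cfc

/-! ### Parseval frames -/

section ParsevalFrame

variable {A : Type*} [NonUnitalCStarAlgebra A] [PartialOrder A] [StarOrderedRing A]
  {E : Type*} [NormedAddCommGroup E] [NormedSpace ℂ E] [SMul A E] [CStarModule A E]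
  {H : Type*} [NormedAddCommGroup H] [NormedSpace ℂ H] [SMul A H] [CStarModule A H]
  {ι : Type*}

theorem norm_sum_mul_star_sq_le (s : Finset ι) (a b : ι → A) :
    ‖∑ i ∈ s, a i * star (b i)‖ ^ 2 ≤
      ‖∑ i ∈ s, a i * star (a i)‖ * ‖∑ i ∈ s, b i * star (b i)‖ := by
  let x : C⋆ᵐᵒᵈ(A, s → A) := (equiv A (s → A)).symm fun i => a i
  let y : C⋆ᵐᵒᵈ(A, s → A) := (equiv A (s → A)).symm fun i => b i
  have h : ‖inner A y x‖ ^ 2 ≤ ‖x‖ ^ 2 * ‖y‖ ^ 2 := by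
    rw [← mul_pow, mul_comm]
    exact pow_le_pow_left₀ (norm_nonneg _) (norm_inner_le _) 2
  rw [pi_norm_sq, pi_norm_sq, pi_inner] at h
  simpa only [x, y, equiv_symm_pi_apply, inner_def,
    Finset.sum_coe_sort s fun i => a i * star (b i),
    Finset.sum_coe_sort s fun i => a i * star (a i),
    Finset.sum_coe_sort s fun i => b i * star (b i)] using h

variable (A) in
/-- The family `x` is a Parseval frame (a standard normalized tight frame) of the Hilbert module:
`∑ i, ⟪z, x i⟫⟪x i, z⟫ = ⟪z, z⟫` with norm convergence, in the order of factors that the left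
action dictates. -/
def IsParsevalFrame (x : ι → E) : Prop :=
  ∀ z : E, HasSum (fun i => inner A (x i) z * star (inner A (x i) z)) (inner A z z)

namespace IsParsevalFrame

variable {x : ι → H} {y : ι → E}

theorem norm_sum_mul_star_le (hx : IsParsevalFrame A x) (s : Finset ι) (z : H) :
    ‖∑ i ∈ s, inner A (x i) z * star (inner A (x i) z)‖ ≤ ‖z‖ ^ 2 := by
  rw [norm_sq_eq A]
  exact CStarAlgebra.norm_le_norm_of_nonneg_of_le
    (Finset.sum_nonneg fun i _ => mul_star_self_nonneg _)
    (sum_le_hasSum s (fun i _ => mul_star_self_nonneg _) (hx z))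

theorem norm_sum_smul_sq_le (hy : IsParsevalFrame A y) (s : Finset ι) (a : ι → A) :
    ‖∑ i ∈ s, a i • y i‖ ^ 2 ≤ ‖∑ i ∈ s, a i * star (a i)‖ := by
  set w := ∑ i ∈ s, a i • y i with hw
  have hinner : inner A w w = ∑ i ∈ s, a i * star (inner A (y i) w) := by
    conv_lhs => rw [hw, ← hw, inner_sum_right]
    exact Finset.sum_congr rfl fun i _ => by rw [inner_op_smul_right, star_inner]
  rcases (sq_nonneg ‖w‖).eq_or_lt with h0 | h0
  · rw [← h0]
    exact norm_nonneg _
  · refine le_of_mul_le_mul_right ?_ h0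
    calc ‖w‖ ^ 2 * ‖w‖ ^ 2 = ‖∑ i ∈ s, a i * star (inner A (y i) w)‖ ^ 2 := by
          rw [norm_sq_eq A, hinner, sq]
      _ ≤ _ := norm_sum_mul_star_sq_le s a fun i => inner A (y i) w
      _ ≤ ‖∑ i ∈ s, a i * star (a i)‖ * ‖w‖ ^ 2 := by
          gcongr
          exact hy.norm_sum_mul_star_le s w

theorem norm_sum_inner_smul_le (hx : IsParsevalFrame A x) (hy : IsParsevalFrame A y)
    (s : Finset ι) (z : H) : ‖∑ i ∈ s, inner A (x i) z • y i‖ ≤ ‖z‖ :=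
  le_of_sq_le_sq ((hy.norm_sum_smul_sq_le s _).trans (hx.norm_sum_mul_star_le s z))
    (norm_nonneg z)

variable [CompleteSpace E]

theorem summable_inner_smul (hx : IsParsevalFrame A x) (hy : IsParsevalFrame A y) (z : H) :
    Summable fun i => inner A (x i) z • y i := by
  refine summable_iff_vanishing_norm.2 fun ε hε => ?_
  obtain ⟨s, hs⟩ := summable_iff_vanishing_norm.1 (hx z).summable (ε ^ 2) (by positivity)
  exact ⟨s, fun t ht => lt_of_pow_lt_pow_left₀ 2 hε.le
    ((hy.norm_sum_smul_sq_le t _).trans_lt (hs t ht))⟩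

/-- The operator `z ↦ ∑ i, ⟪x i, z⟫ • y i`: the analysis operator of the frame `x` followed by the
synthesis operator of the frame `y`. -/
def mixedOperator (hx : IsParsevalFrame A x) (hy : IsParsevalFrame A y) : H →L[ℂ] E :=
  LinearMap.mkContinuous
    { toFun := fun z => ∑' i, inner A (x i) z • y i
      map_add' := fun z w => by
        rw [← (hx.summable_inner_smul hy z).tsum_add (hx.summable_inner_smul hy w)]
        simp only [CStarModule.inner_add_right, alg_add_smul]
      map_smul' := fun c z => by
        simp only [inner_smul_right_complex, complex_smul_alg_smul, RingHom.id_apply]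
        exact (hx.summable_inner_smul hy z).tsum_const_smul c } 1
    fun z => by
      rw [one_mul]
      exact le_of_tendsto' (hx.summable_inner_smul hy z).hasSum.norm
        fun s => hx.norm_sum_inner_smul_le hy s z

theorem hasSum_mixedOperator (hx : IsParsevalFrame A x) (hy : IsParsevalFrame A y) (z : H) :
    HasSum (fun i => inner A (x i) z • y i) (hx.mixedOperator hy z) :=
  (hx.summable_inner_smul hy z).hasSum

theorem norm_mixedOperator_le (hx : IsParsevalFrame A x) (hy : IsParsevalFrame A y) :
    ‖hx.mixedOperator hy‖ ≤ 1 :=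
  LinearMap.mkContinuous_norm_le _ zero_le_one _

theorem hasSum_inner_mixedOperator (hx : IsParsevalFrame A x) (hy : IsParsevalFrame A y) (z : H)
    (w : E) : HasSum (fun i => inner A (x i) z * star (inner A (y i) w))
      (inner A w (hx.mixedOperator hy z)) := by
  have h := (hx.hasSum_mixedOperator hy z).mapL (innerSL (A := A) w)
  simpa only [innerSL_apply, inner_op_smul_right, star_inner] using h

variable [CompleteSpace H]

theorem isAdjoint_mixedOperator (hx : IsParsevalFrame A x) (hy : IsParsevalFrame A y) :
    IsAdjoint A (hx.mixedOperator hy) (hy.mixedOperator hx) := fun z w => by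
  refine HasSum.unique ?_ (hy.hasSum_inner_mixedOperator hx w z)
  simpa only [star_mul, star_star, star_inner] using (hx.hasSum_inner_mixedOperator hy z w).star

theorem mixedOperator_self (hx : IsParsevalFrame A x) :
    hx.mixedOperator hx = ContinuousLinearMap.id ℂ H := by
  have hadj := hx.isAdjoint_mixedOperator hx
  let F : adjointable A H := ⟨hx.mixedOperator hx, _, hadj⟩
  have hF : IsSelfAdjoint F := adjointable.isSelfAdjoint_iff.2 hadj
  have hinner : ∀ z : H, inner A z (F.1 z) = inner A z z := fun z =>
    (hx.hasSum_inner_mixedOperator hx z z).unique (hx z)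
  have hone : F = 1 := le_antisymm
    ((adjointable.le_iff hF (.one _)).2 fun z => (hinner z).le)
    ((adjointable.le_iff (.one _) hF).2 fun z => (hinner z).ge)
  exact congrArg Subtype.val hone

variable {I : TwoSidedIdeal A} [IsClosed (I : Set A)]

theorem rel_mixedOperator
    {φ : Iso I.ringCon.Quotient (H ⧸ idealSubmodule H I) (E ⧸ idealSubmodule E I)}
    (hx : IsParsevalFrame A x) (hy : IsParsevalFrame A y) (h : ∀ i, φ.Rel (x i) (y i)) (z : H) :
    φ.Rel z (hx.mixedOperator hy z) := by
  have hz := hx.hasSum_mixedOperator hx z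
  rw [hx.mixedOperator_self] at hz
  refine .of_tendsto (fun s => .sum s fun i => (h i).alg_smul ?_) hz (hx.hasSum_mixedOperator hy z)
  rw [sub_self]
  exact I.zero_mem

end IsParsevalFrame

end ParsevalFrame

/-! ### Parseval frames from generators -/

section GeneratingFamily

variable {A E : Type*} [NormedAddCommGroup E] [NormedSpace ℂ E] [SMul A E] {ι κ : Type*}

variable (A) in
/-- The family `x` generates the Hilbert module: the `A`-linear span of `x` is dense. -/
def IsGenerating (x : ι → E) : Prop :=
  Dense (Submodule.span ℂ {y : E | ∃ (a : A) (i : ι), y = a • x i} : Set E)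

theorem IsCountablyGenerated.exists_isGenerating (h : IsCountablyGenerated A E) :
    ∃ x : ℕ → E, IsGenerating A x := by
  obtain ⟨s, hs, hd⟩ := h
  obtain ⟨x, hx⟩ := (hs.insert 0).exists_eq_range (Set.insert_nonempty 0 s)
  refine ⟨x, hd.mono (Submodule.span_mono ?_)⟩
  rintro _ ⟨a, y, hy, rfl⟩
  obtain ⟨i, rfl⟩ : y ∈ Set.range x := hx ▸ Set.mem_insert_of_mem 0 hy
  exact ⟨a, i, rfl⟩

theorem exists_ne_zero_summable_norm_smul_sq [Countable ι] (x : ι → E) :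
    ∃ c : ι → ℂ, (∀ i, c i ≠ 0) ∧ Summable fun i => ‖c i • x i‖ ^ 2 := by
  obtain ⟨δ, hδ, _, hsum, -⟩ := NNReal.exists_pos_sum_of_countable one_ne_zero ι
  have hδ' : ∀ i, 0 < (δ i : ℝ) := hδ
  refine ⟨fun i => (√(δ i / (1 + ‖x i‖ ^ 2)) : ℝ), fun i => ?_,
    .of_nonneg_of_le (fun i => sq_nonneg _) (fun i => ?_) (NNReal.summable_coe.2 hsum.summable)⟩
  · have := hδ' i
    exact Complex.ofReal_ne_zero.2 (by positivity)
  · rw [norm_smul, mul_pow, Complex.norm_real, Real.norm_eq_abs, sq_abs,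
      Real.sq_sqrt (by positivity), div_mul_eq_mul_div]
    exact div_le_of_le_mul₀ (by positivity) (by positivity) (by gcongr; linarith)

namespace IsGenerating

variable [NonUnitalCStarAlgebra A] [PartialOrder A] [StarOrderedRing A] [CStarModule A E]
  {x : ι → E}

theorem of_smul {x' : κ → E} (hx : IsGenerating A x)
    (h : ∀ i, ∃ (c : ℂ) (j : κ), x i = c • x' j) : IsGenerating A x' := by
  refine Dense.mono (Submodule.span_le.2 ?_) hx
  rintro _ ⟨a, i, rfl⟩
  obtain ⟨c, j, hc⟩ := h i
  rw [hc, alg_smul_complex_smul]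
  exact Submodule.smul_mem _ _ (Submodule.subset_span ⟨a, j, rfl⟩)

theorem tendsto_apply (hx : IsGenerating A x) {T : ℕ → adjointable A E} (hT : ∀ n, ‖T n‖ ≤ 1)
    (h : ∀ i, Tendsto (fun n => (T n).1 (x i)) atTop (𝓝 (x i))) (z : E) :
    Tendsto (fun n => (T n).1 z) atTop (𝓝 z) := by
  let K : Submodule ℂ E :=
    { carrier := {z | Tendsto (fun n => (T n).1 z) atTop (𝓝 z)}
      zero_mem' := by simp
      add_mem' := fun hz hw => by simpa using hz.add hw
      smul_mem' := fun c z hz => by simpa using hz.const_smul c }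
  have hspan : Submodule.span ℂ {y : E | ∃ (a : A) (i : ι), y = a • x i} ≤ K := by
    refine Submodule.span_le.2 ?_
    rintro _ ⟨a, i, rfl⟩
    have hmap : ∀ n, (T n).1 (a • x i) = algSMulCLM A E a ((T n).1 (x i)) := fun n =>
      (T n).2.choose_spec.map_alg_smul a (x i)
    change Tendsto (fun n => (T n).1 (a • x i)) atTop (𝓝 (a • x i))
    simp only [hmap]
    exact ((algSMulCLM A E a).continuous.tendsto (x i)).comp (h i)
  have hequi : UniformEquicontinuous fun n => ⇑(T n).1 :=
    LipschitzWith.uniformEquicontinuous _ 1 fun n => (T n).1.lipschitzWith_of_opNorm_le (hT n)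
  have hclosed : IsClosed (K : Set E) :=
    hequi.equicontinuous.isClosed_setOfPred_tendsto continuous_id
  exact closure_minimal hspan hclosed (hx z)

variable [CompleteSpace E]

theorem tendsto_cfc_cutoff (hx : IsGenerating A x) {p : adjointable A E}
    (hp : HasSum (fun i => rankOneSelf A (x i)) p) (z : E) :
    Tendsto (fun n => (cfc (cutoff n) p).1 z) atTop (𝓝 z) :=
  hx.tendsto_apply (fun n => norm_cfc_cutoff_le n) (fun i => tendsto_cfc_cutoff_of_rankOneSelf_le
    (le_hasSum hp i fun j _ => rankOneSelf_nonneg (x j))) z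

end IsGenerating

end GeneratingFamily

section NonnegSum

variable {A : Type*} [NonUnitalCStarAlgebra A] [PartialOrder A] [StarOrderedRing A] {ι : Type*}

theorem hasSum_of_nonneg_of_mem_closure {f : ι → A} {a : A} (hf : ∀ i, 0 ≤ f i)
    (hle : ∀ s : Finset ι, ∑ i ∈ s, f i ≤ a)
    (ha : a ∈ closure (Set.range fun s : Finset ι => ∑ i ∈ s, f i)) : HasSum f a := by
  rw [HasSum, SummationFilter.unconditional_filter, Metric.tendsto_nhds]
  intro ε hε
  obtain ⟨_, ⟨s, rfl⟩, hs⟩ := Metric.mem_closure_iff.1 ha ε hε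
  filter_upwards [eventually_ge_atTop s] with t hst
  refine lt_of_le_of_lt ?_ hs
  rw [dist_comm, dist_eq_norm, dist_eq_norm]
  exact CStarAlgebra.norm_le_norm_of_nonneg_of_le (sub_nonneg.2 (hle t))
    (sub_le_sub_left (Finset.sum_le_sum_of_subset_of_nonneg hst fun i _ _ => hf i) a)

theorem hasSum_prod_of_nonneg {f : ℕ × ι → A} {g : ℕ → A} {a : A} (hf : ∀ j, 0 ≤ f j)
    (hg : ∀ n, HasSum (fun i => f (n, i)) (g n))
    (ha : Tendsto (fun N => ∑ n ∈ Finset.range N, g n) atTop (𝓝 a)) : HasSum f a := by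
  classical
  have hsum : ∀ N, HasSum (fun i => ∑ n ∈ Finset.range N, f (n, i)) (∑ n ∈ Finset.range N, g n) :=
    fun N => hasSum_sum fun n _ => hg n
  have hmono : Monotone fun N => ∑ n ∈ Finset.range N, g n := monotone_nat_of_le_succ fun N => by
    rw [Finset.sum_range_succ]
    exact le_add_of_nonneg_right ((hg N).nonneg fun i => hf _)
  refine hasSum_of_nonneg_of_mem_closure hf (fun s => ?_)
    (isClosed_closure.mem_of_tendsto ha (.of_forall fun N => ?_))
  · obtain ⟨N, hN⟩ := (s.image Prod.fst).exists_nat_subset_range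
    have hs : s ⊆ Finset.range N ×ˢ s.image Prod.snd := fun j hj => Finset.mem_product.2
      ⟨hN (Finset.mem_image_of_mem _ hj), Finset.mem_image_of_mem _ hj⟩
    calc ∑ j ∈ s, f j ≤ ∑ j ∈ Finset.range N ×ˢ s.image Prod.snd, f j :=
          Finset.sum_le_sum_of_subset_of_nonneg hs fun j _ _ => hf j
      _ = ∑ i ∈ s.image Prod.snd, ∑ n ∈ Finset.range N, f (n, i) := Finset.sum_product_right _ _ _
      _ ≤ ∑ n ∈ Finset.range N, g n :=
          sum_le_hasSum _ (fun i _ => Finset.sum_nonneg fun n _ => hf _) (hsum N)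
      _ ≤ a := hmono.ge_of_tendsto ha N
  · refine mem_closure_of_tendsto (hsum N) (.of_forall fun t => ⟨Finset.range N ×ˢ t, ?_⟩)
    exact Finset.sum_product_right _ _ _

end NonnegSum

section CutoffFrame

variable {A : Type*} [NonUnitalCStarAlgebra A] [PartialOrder A] [StarOrderedRing A]
  {E : Type*} [NormedAddCommGroup E] [NormedSpace ℂ E] [SMul A E] [CStarModule A E]
  [CompleteSpace E] {ι : Type*} {x : ι → E}

theorem summable_rankOneSelf (hx : Summable fun i => ‖x i‖ ^ 2) :
    Summable fun i => rankOneSelf A (x i) :=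
  .of_norm (by simpa only [norm_rankOneSelf] using hx)

variable {p : adjointable A E}

theorem nonneg_of_hasSum_rankOneSelf (hp : HasSum (fun i => rankOneSelf A (x i)) p) : 0 ≤ p :=
  hp.nonneg fun i => rankOneSelf_nonneg (x i)

theorem hasSum_rankOneSelf_cfc_cutoffRoot (hp : HasSum (fun i => rankOneSelf A (x i)) p) (n : ℕ) :
    HasSum (fun i => rankOneSelf A ((cfc (cutoffRoot n) p).1 (x i)))
      (cfc (cutoff (n + 1)) p - cfc (cutoff n) p) := by
  have hstar : star (cfc (cutoffRoot n) p) = cfc (cutoffRoot n) p :=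
    (cfc_predicate (cutoffRoot n) p).star_eq
  have hconj := (hp.mul_left (cfc (cutoffRoot n) p)).mul_right (star (cfc (cutoffRoot n) p))
  simp only [mul_rankOneSelf_mul_star] at hconj
  rwa [hstar, cfc_cutoffRoot_mul_mul (nonneg_of_hasSum_rankOneSelf hp)] at hconj

theorem IsGenerating.isParsevalFrame_cutoffRoot (hx : IsGenerating A x)
    (hp : HasSum (fun i => rankOneSelf A (x i)) p) :
    IsParsevalFrame A fun j : ℕ × ι => (cfc (cutoffRoot j.1) p).1 (x j.2) := fun z => by
  let eval : adjointable A E →L[ℂ] A :=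
    innerSL z ∘L ContinuousLinearMap.apply ℂ E z ∘L
      (Subalgebra.toSubmodule (adjointable A E)).subtypeL
  have heval : ∀ a, eval a = inner A z (a.1 z) := fun _ => rfl
  refine hasSum_prod_of_nonneg
    (g := fun n => eval (cfc (cutoff (n + 1)) p - cfc (cutoff n) p))
    (fun j => mul_star_self_nonneg _) (fun n => ?_) ?_
  · simpa only [heval, inner_rankOneSelf_apply] using
      (hasSum_rankOneSelf_cfc_cutoffRoot hp n).mapL eval
  · simp only [← map_sum, Finset.sum_range_sub fun n => cfc (cutoff n) p, cfc_cutoff_zero, sub_zero]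
    exact tendsto_inner tendsto_const_nhds (hx.tendsto_cfc_cutoff hp z)

end CutoffFrame

section ContractionLift

variable {A : Type*} [NonUnitalCStarAlgebra A] [PartialOrder A] [StarOrderedRing A]
  {E : Type*} [NormedAddCommGroup E] [NormedSpace ℂ E] [SMul A E] [CStarModule A E]
  {H : Type*} [NormedAddCommGroup H] [NormedSpace ℂ H] [SMul A H] [CStarModule A H]
  {I : TwoSidedIdeal A} [IsClosed (I : Set A)]

theorem Iso.exists_isGenerating_rel (hH : IsCountablyGenerated A H) (hE : IsCountablyGenerated A E)
    (φ : Iso I.ringCon.Quotient (H ⧸ idealSubmodule H I) (E ⧸ idealSubmodule E I)) :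
    ∃ (x : ℕ ⊕ ℕ → H) (y : ℕ ⊕ ℕ → E), IsGenerating A x ∧ IsGenerating A y ∧
      (∀ i, φ.Rel (x i) (y i)) ∧ (Summable fun i => ‖x i‖ ^ 2) ∧ Summable fun i => ‖y i‖ ^ 2 := by
  obtain ⟨u, hu⟩ := hH.exists_isGenerating
  obtain ⟨v, hv⟩ := hE.exists_isGenerating
  choose u' hu' using fun n => Iso.Rel.exists_right φ (u n)
  choose v' hv' using fun n => Iso.Rel.exists_left φ (v n)
  let x : ℕ ⊕ ℕ → H := Sum.elim u v'
  let y : ℕ ⊕ ℕ → E := Sum.elim u' v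
  have hxy : ∀ i, φ.Rel (x i) (y i) := Sum.rec hu' hv'
  obtain ⟨c, hc, hsum⟩ := exists_ne_zero_summable_norm_smul_sq fun i => (x i, y i)
  refine ⟨fun i => c i • x i, fun i => c i • y i,
    hu.of_smul fun n => ⟨(c (.inl n))⁻¹, .inl n, (inv_smul_smul₀ (hc _) _).symm⟩,
    hv.of_smul fun n => ⟨(c (.inr n))⁻¹, .inr n, (inv_smul_smul₀ (hc _) _).symm⟩,
    fun i => (hxy i).smul (c i),
    .of_nonneg_of_le (fun i => sq_nonneg _) (fun i => ?_) hsum,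
    .of_nonneg_of_le (fun i => sq_nonneg _) (fun i => ?_) hsum⟩
  · gcongr
    exact norm_fst_le (c i • (x i, y i))
  · gcongr
    exact norm_snd_le (c i • (x i, y i))

theorem Iso.exists_contraction_lift [CompleteSpace H] [CompleteSpace E]
    (hH : IsCountablyGenerated A H) (hE : IsCountablyGenerated A E)
    (φ : Iso I.ringCon.Quotient (H ⧸ idealSubmodule H I) (E ⧸ idealSubmodule E I)) :
    ∃ (ψ : H →L[ℂ] E) (ψ' : E →L[ℂ] H), IsAdjoint A ψ ψ' ∧ ‖ψ‖ ≤ 1 ∧ ∀ h, φ.Rel h (ψ h) := by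
  obtain ⟨x, y, hx, hy, hxy, hsumx, hsumy⟩ := φ.exists_isGenerating_rel hH hE
  obtain ⟨p, hp⟩ := summable_rankOneSelf (A := A) hsumx
  obtain ⟨q, hq⟩ := summable_rankOneSelf (A := A) hsumy
  have hpq : (p, q) ∈ φ.intertwined :=
    Iso.hasSum_mem_intertwined hp hq fun i => (hxy i).rankOneSelf_mem_intertwined
  have hframes : ∀ j : ℕ × (ℕ ⊕ ℕ), φ.Rel ((cfc (cutoffRoot j.1) p).1 (x j.2))
      ((cfc (cutoffRoot j.1) q).1 (y j.2)) := fun j =>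
    cfc_prod_mem φ.isClosed_intertwined (continuous_cutoffRoot j.1)
      (nonneg_of_hasSum_rankOneSelf hp).isSelfAdjoint
      (nonneg_of_hasSum_rankOneSelf hq).isSelfAdjoint hpq _ _ (hxy j.2)
  have hx' := hx.isParsevalFrame_cutoffRoot hp
  have hy' := hy.isParsevalFrame_cutoffRoot hq
  exact ⟨hx'.mixedOperator hy', hy'.mixedOperator hx', hx'.isAdjoint_mixedOperator hy',
    hx'.norm_mixedOperator_le hy', hx'.rel_mixedOperator hy' hframes⟩

end ContractionLift

/-! ### The Halmos dilation -/

section IsoConstructions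

variable {A : Type*} [NonUnitalCStarAlgebra A] [PartialOrder A] [StarOrderedRing A]
  {X : Type*} [NormedAddCommGroup X] [NormedSpace ℂ X] [SMul A X] [CStarModule A X]
  {Y : Type*} [NormedAddCommGroup Y] [NormedSpace ℂ Y] [SMul A Y] [CStarModule A Y]

/-- The isomorphism given by a map `f` with adjoint and inverse `g`.  Linearity of `f` is
automatic. -/
def Iso.ofAdjointInverse (f : X → Y) (g : Y → X)
    (hadj : ∀ x y, inner A (f x) y = inner A x (g y)) (hgf : ∀ x, g (f x) = x)
    (hfg : ∀ y, f (g y) = y) : Iso A X Y :=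
  have hadj' (y : Y) (x : X) : inner A y (f x) = inner A (g y) x := by
    rw [← star_inner, hadj, star_inner]
  { toFun := f
    invFun := g
    left_inv := hgf
    right_inv := hfg
    map_add' := fun x x' => ext_inner (A := A) fun z => by
      simp only [hadj', CStarModule.inner_add_right]
    map_smul' := fun c x => ext_inner (A := A) fun z => by
      simp only [hadj', inner_smul_right_complex, RingHom.id_apply]
    map_alg_smul' := fun a x => ext_inner (A := A) fun z => by
      simp only [hadj', inner_op_smul_right]
    inner_map_map' := fun x x' => by rw [hadj, hgf] }

variable {X₀ : Type*} [NormedAddCommGroup X₀] [NormedSpace ℂ X₀] [SMul A X₀] [CStarModule A X₀]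
  {Y₀ : Type*} [NormedAddCommGroup Y₀] [NormedSpace ℂ Y₀] [SMul A Y₀] [CStarModule A Y₀]

theorem Iso.exists_restrict (U : Iso A X Y) {j : X₀ → X} {j' : Y₀ → Y}
    (hj : ∀ x x', inner A (j x) (j x') = inner A x x')
    (hj' : ∀ y y', inner A (j' y) (j' y') = inner A y y')
    (hto : ∀ x, ∃ y, j' y = U (j x)) (hfrom : ∀ y, ∃ x, U (j x) = j' y) :
    ∃ Φ : Iso A X₀ Y₀, ∀ x, j' (Φ x) = U (j x) := by
  choose f hf using hto
  choose g hg using hfrom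
  have hU (x x' : X₀) : inner A (U (j x)) (U (j x')) = inner A x x' :=
    (U.inner_map_map' _ _).trans (hj x x')
  refine ⟨.ofAdjointInverse f g (fun x y => ?_) (fun x => ?_) (fun y => ?_), hf⟩
  · rw [← hj', hf, ← hg, hU]
  · exact ext_inner (A := A) fun z => by rw [← hU, hg, hf, hU]
  · exact ext_inner (A := A) fun z => by rw [← hj', hf, hg, hj']

end IsoConstructions

section Defect

variable {A : Type*} [NonUnitalCStarAlgebra A] [PartialOrder A] [StarOrderedRing A]
  {E : Type*} [NormedAddCommGroup E] [NormedSpace ℂ E] [SMul A E] [CStarModule A E]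
  {H : Type*} [NormedAddCommGroup H] [NormedSpace ℂ H] [SMul A H] [CStarModule A H]
  {ψ : H →L[ℂ] E} {ψ' : E →L[ℂ] H}

/-- The pairs of adjointable operators on `H` and `E` intertwined by `ψ` and by its adjoint. -/
def IsAdjoint.intertwined (h : IsAdjoint A ψ ψ') :
    StarSubalgebra ℂ (adjointable A H × adjointable A E) where
  carrier := {T | ψ ∘L T.1.1 = T.2.1 ∘L ψ ∧ ψ' ∘L T.2.1 = T.1.1 ∘L ψ'}
  mul_mem' {T T'} hT hT' := by
    refine ⟨ContinuousLinearMap.ext fun x => ?_, ContinuousLinearMap.ext fun y => ?_⟩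
    · exact (DFunLike.congr_fun hT.1 (T'.1.1 x)).trans
        (congrArg T.2.1 (DFunLike.congr_fun hT'.1 x))
    · exact (DFunLike.congr_fun hT.2 (T'.2.1 y)).trans
        (congrArg T.1.1 (DFunLike.congr_fun hT'.2 y))
  add_mem' {T T'} hT hT' := by
    constructor
    · change ψ ∘L (T.1.1 + T'.1.1) = (T.2.1 + T'.2.1) ∘L ψ
      rw [ContinuousLinearMap.comp_add, ContinuousLinearMap.add_comp, hT.1, hT'.1]
    · change ψ' ∘L (T.2.1 + T'.2.1) = (T.1.1 + T'.1.1) ∘L ψ'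
      rw [ContinuousLinearMap.comp_add, ContinuousLinearMap.add_comp, hT.2, hT'.2]
  algebraMap_mem' c :=
    ⟨ContinuousLinearMap.ext (map_smul ψ c), ContinuousLinearMap.ext (map_smul ψ' c)⟩
  star_mem' {T} hT := by
    have hH := (adjointable.isAdjoint_star T.1)
    have hE := (adjointable.isAdjoint_star T.2)
    have h₁ : IsAdjoint A (ψ' ∘L T.2.1) ((star T).2.1 ∘L ψ) := h.symm.comp hE
    have h₂ : IsAdjoint A (ψ ∘L T.1.1) ((star T).1.1 ∘L ψ') := h.comp hH
    rw [hT.2] at h₁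
    rw [hT.1] at h₂
    exact ⟨(hH.comp h.symm).unique h₁, (hE.comp h).unique h₂⟩

theorem IsAdjoint.isClosed_intertwined (h : IsAdjoint A ψ ψ') :
    IsClosed (h.intertwined : Set (adjointable A H × adjointable A E)) := by
  have hH : Continuous fun T : adjointable A H × adjointable A E => T.1.1 :=
    continuous_subtype_val.comp continuous_fst
  have hE : Continuous fun T : adjointable A H × adjointable A E => T.2.1 :=
    continuous_subtype_val.comp continuous_snd
  exact (isClosed_eq (continuous_const.clm_comp hH) (hE.clm_comp continuous_const)).inter
    (isClosed_eq (continuous_const.clm_comp hE) (hH.clm_comp continuous_const))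

/-- The defect operator `1 - ψ⋆ψ`. -/
def IsAdjoint.defect (h : IsAdjoint A ψ ψ') : adjointable A H :=
  ⟨ContinuousLinearMap.id ℂ H - ψ' ∘L ψ, _, IsAdjoint.id.sub (h.symm.comp h)⟩

theorem IsAdjoint.isSelfAdjoint_defect (h : IsAdjoint A ψ ψ') : IsSelfAdjoint h.defect :=
  adjointable.isSelfAdjoint_iff.2 (IsAdjoint.id.sub (h.symm.comp h))

variable [CompleteSpace H]

theorem IsAdjoint.defect_nonneg (h : IsAdjoint A ψ ψ') (hψ : ‖ψ‖ ≤ 1) : 0 ≤ h.defect := by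
  have hself : IsSelfAdjoint (1 - h.defect) := (IsSelfAdjoint.one _).sub h.isSelfAdjoint_defect
  have hval : (1 - h.defect).1 = ψ' ∘L ψ := sub_sub_cancel _ _
  have hnorm : ‖1 - h.defect‖ ≤ 1 := calc
    ‖(1 - h.defect).1‖ ≤ ‖ψ'‖ * ‖ψ‖ := hval ▸ ψ'.opNorm_comp_le ψ
    _ ≤ 1 := mul_le_one₀ (h.norm_eq ▸ hψ) (norm_nonneg _) hψ
  have hle := hself.le_algebraMap_norm_self.trans (algebraMap_mono (adjointable A H) hnorm)
  rwa [map_one, sub_le_self_iff] at hle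

/-- The square root `√(1 - ψ⋆ψ)` of the defect operator of a contraction `ψ`. -/
def IsAdjoint.defectSqrt (h : IsAdjoint A ψ ψ') : H →L[ℂ] H := (cfc Real.sqrt h.defect).1

theorem cfc_sqrt_mul_self {B : Type*} [CStarAlgebra B] [PartialOrder B] [StarOrderedRing B] {b : B}
    (hb : 0 ≤ b) : cfc Real.sqrt b * cfc Real.sqrt b = b := by
  rw [← cfc_mul Real.sqrt Real.sqrt b Real.continuous_sqrt.continuousOn
    Real.continuous_sqrt.continuousOn]
  conv_rhs => rw [← cfc_id' ℝ b]
  exact cfc_congr fun t ht => Real.mul_self_sqrt (spectrum_nonneg_of_nonneg hb ht)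

theorem isPositiveSqrt_cfc_sqrt {a : adjointable A H} (ha : 0 ≤ a) :
    IsPositiveSqrt A (cfc Real.sqrt a : adjointable A H).1 a.1 :=
  ⟨adjointable.isSelfAdjoint_iff.1 (cfc_predicate _ a),
    adjointable.inner_nonneg (cfc_nonneg fun t _ => Real.sqrt_nonneg t),
    congrArg Subtype.val (cfc_sqrt_mul_self ha)⟩

theorem IsAdjoint.isPositiveSqrt_defectSqrt (h : IsAdjoint A ψ ψ') (hψ : ‖ψ‖ ≤ 1) :
    IsPositiveSqrt A h.defectSqrt (ContinuousLinearMap.id ℂ H - ψ' ∘L ψ) :=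
  isPositiveSqrt_cfc_sqrt (h.defect_nonneg hψ)

theorem IsAdjoint.comp_defectSqrt [CompleteSpace E] (h : IsAdjoint A ψ ψ') :
    ψ ∘L h.defectSqrt = h.symm.defectSqrt ∘L ψ := by
  have hmem : (h.defect, h.symm.defect) ∈ h.intertwined :=
    ⟨ContinuousLinearMap.ext fun _ => map_sub ψ _ _,
      ContinuousLinearMap.ext fun _ => map_sub ψ' _ _⟩
  exact (cfc_prod_mem h.isClosed_intertwined Real.continuous_sqrt h.isSelfAdjoint_defect
    h.symm.isSelfAdjoint_defect hmem).1

end Defect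

section BlockMatrix

variable {A : Type*} {E : Type*} [NormedAddCommGroup E] [NormedSpace ℂ E]
  {H : Type*} [NormedAddCommGroup H] [NormedSpace ℂ H]
  {ψ : H →L[ℂ] E} {ψ' : E →L[ℂ] H} {R : H →L[ℂ] H} {S : E →L[ℂ] E}

variable (A ψ ψ' R S) in
/-- The block matrix `(ψ, -S; R, ψ')`. -/
def halmosMap (z : C⋆ᵐᵒᵈ(A, H × E)) : C⋆ᵐᵒᵈ(A, E × H) :=
  pair A (ψ z.1 - S z.2) (R z.1 + ψ' z.2)

theorem halmosMap_halmosMap (hR : R ∘L R = ContinuousLinearMap.id ℂ H - ψ' ∘L ψ)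
    (hS : S ∘L S = ContinuousLinearMap.id ℂ E - ψ ∘L ψ') (hψR : ψ ∘L R = S ∘L ψ)
    (hψS : ψ' ∘L S = R ∘L ψ') (z : C⋆ᵐᵒᵈ(A, H × E)) :
    halmosMap A ψ' ψ (-S) (-R) (halmosMap A ψ ψ' R S z) = z := by
  have hRR (x : H) : R (R x) = x - ψ' (ψ x) := DFunLike.congr_fun hR x
  have hSS (y : E) : S (S y) = y - ψ (ψ' y) := DFunLike.congr_fun hS y
  have hψR' (x : H) : ψ (R x) = S (ψ x) := DFunLike.congr_fun hψR x
  have hψS' (y : E) : ψ' (S y) = R (ψ' y) := DFunLike.congr_fun hψS y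
  refine (equiv A (H × E)).injective (Prod.ext ?_ ?_)
  · change ψ' (ψ z.1 - S z.2) - (-R) (R z.1 + ψ' z.2) = z.1
    simp only [map_sub, map_add, _root_.neg_apply, hRR, hψS']
    abel
  · change (-S) (ψ z.1 - S z.2) + ψ (R z.1 + ψ' z.2) = z.2
    simp only [map_sub, map_add, _root_.neg_apply, hSS, hψR']
    abel

theorem halmosMap_neg_pair (x : H) (y : E) :
    halmosMap A ψ' ψ (-S) (-R) (pair A y x) = pair A (ψ' y + R x) (ψ x - S y) := by
  change pair A (ψ' y - (-R) x) ((-S) y + ψ x) = _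
  rw [_root_.neg_apply, _root_.neg_apply, sub_neg_eq_add, neg_add_eq_sub]

end BlockMatrix

section Halmos

variable {A : Type*} [NonUnitalCStarAlgebra A] [PartialOrder A] [StarOrderedRing A]
  {E : Type*} [NormedAddCommGroup E] [NormedSpace ℂ E] [SMul A E] [CStarModule A E]
  {H : Type*} [NormedAddCommGroup H] [NormedSpace ℂ H] [SMul A H] [CStarModule A H]
  {ψ : H →L[ℂ] E} {ψ' : E →L[ℂ] H} {R : H →L[ℂ] H} {S : E →L[ℂ] E}

theorem inner_halmosMap (h : IsAdjoint A ψ ψ') (hR : IsAdjoint A R R) (hS : IsAdjoint A S S)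
    (z : C⋆ᵐᵒᵈ(A, H × E)) (w : C⋆ᵐᵒᵈ(A, E × H)) :
    inner A (halmosMap A ψ ψ' R S z) w = inner A z (halmosMap A ψ' ψ (-S) (-R) w) := by
  simp only [halmosMap, pair, prod_inner, equiv_symm_fst, equiv_symm_snd,
    CStarModule.inner_sub_left, CStarModule.inner_add_left, CStarModule.inner_sub_right,
    CStarModule.inner_add_right, _root_.neg_apply, CStarModule.inner_neg_right,
    h z.1 w.1, h.symm z.2 w.2, hR z.1 w.2, hS z.2 w.1]
  abel

variable [CompleteSpace H] [CompleteSpace E]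

/-- The Halmos unitary dilation of an adjointable contraction. -/
def IsAdjoint.halmos (h : IsAdjoint A ψ ψ') (hψ : ‖ψ‖ ≤ 1) :
    Iso A C⋆ᵐᵒᵈ(A, H × E) C⋆ᵐᵒᵈ(A, E × H) :=
  have hR := h.isPositiveSqrt_defectSqrt hψ
  have hS := h.symm.isPositiveSqrt_defectSqrt (h.norm_eq ▸ hψ)
  have hψR := h.comp_defectSqrt
  have hψS := h.symm.comp_defectSqrt
  .ofAdjointInverse (halmosMap A ψ ψ' h.defectSqrt h.symm.defectSqrt)
    (halmosMap A ψ' ψ (-h.symm.defectSqrt) (-h.defectSqrt))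
    (inner_halmosMap h hR.1 hS.1) (halmosMap_halmosMap hR.2.2 hS.2.2 hψR hψS)
    (by
      have hinv := halmosMap_halmosMap (A := A) (ψ := ψ') (ψ' := ψ) (R := -h.symm.defectSqrt)
        (S := -h.defectSqrt) (by simpa using hS.2.2) (by simpa using hR.2.2) (by simpa using hψS)
        (by simpa using hψR)
      simpa only [neg_neg] using hinv)

theorem IsAdjoint.halmos_pair (h : IsAdjoint A ψ ψ') (hψ : ‖ψ‖ ≤ 1) (x : H) (y : E) :
    h.halmos hψ (pair A x y) =
      pair A (ψ x - h.symm.defectSqrt y) (h.defectSqrt x + ψ' y) := rfl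

theorem IsAdjoint.halmos_pair_eq (h : IsAdjoint A ψ ψ') (hψ : ‖ψ‖ ≤ 1) (x : H) (y : E) :
    h.halmos hψ (pair A (ψ' y + h.defectSqrt x) (ψ x - h.symm.defectSqrt y)) = pair A y x := by
  rw [← halmosMap_neg_pair]
  exact (h.halmos hψ).right_inv (pair A y x)

end Halmos

section Lift

variable {A : Type*} [NonUnitalCStarAlgebra A] [PartialOrder A] [StarOrderedRing A]
  {E : Type*} [NormedAddCommGroup E] [NormedSpace ℂ E] [SMul A E] [CStarModule A E]
  {H : Type*} [NormedAddCommGroup H] [NormedSpace ℂ H] [SMul A H] [CStarModule A H]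
  [CompleteSpace H] {I : TwoSidedIdeal A}
  {ψ : H →L[ℂ] E} {ψ' : E →L[ℂ] H}

theorem IsAdjoint.defectSqrt_apply_mem_idealSubmodule (h : IsAdjoint A ψ ψ') (hψ : ‖ψ‖ ≤ 1) {x : H}
    (hx : inner A (ψ x) (ψ x) - inner A x x ∈ I) : h.defectSqrt x ∈ idealSubmodule H I := by
  have hR := h.isPositiveSqrt_defectSqrt hψ
  have hRR : h.defectSqrt (h.defectSqrt x) = x - ψ' (ψ x) := DFunLike.congr_fun hR.2.2 x
  refine mem_idealSubmodule_of_inner_self_mem I ?_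
  rw [hR.1, hRR, CStarModule.inner_sub_right, ← h, ← neg_sub]
  exact I.neg_mem hx

theorem IsAdjoint.exists_halmos_restrict [CompleteSpace E] (h : IsAdjoint A ψ ψ') (hψ : ‖ψ‖ ≤ 1)
    (hR : ∀ x, h.defectSqrt x ∈ idealSubmodule H I)
    (hS : ∀ y, h.symm.defectSqrt y ∈ idealSubmodule E I) :
    ∃ Φ : Iso A C⋆ᵐᵒᵈ(A, H × idealSubmodule E I) C⋆ᵐᵒᵈ(A, E × idealSubmodule H I),
      ∀ (x : H) (y : idealSubmodule E I),
        (Φ (pair A x y)).1 = (h.halmos hψ (pair A x (y : E))).1 ∧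
        ((Φ (pair A x y)).2 : H) = (h.halmos hψ (pair A x (y : E))).2 := by
  obtain ⟨Φ, hΦ⟩ := (h.halmos hψ).exists_restrict
    (j := fun z : C⋆ᵐᵒᵈ(A, H × idealSubmodule E I) => pair A z.1 (z.2 : E))
    (j' := fun z : C⋆ᵐᵒᵈ(A, E × idealSubmodule H I) => pair A z.1 (z.2 : H))
    (fun _ _ => rfl) (fun _ _ => rfl)
    (fun z => ⟨pair A (ψ z.1 - h.symm.defectSqrt z.2) ⟨h.defectSqrt z.1 + ψ' z.2,
      add_mem (hR _) (h.symm.mapsTo_idealSubmodule I z.2.2)⟩, rfl⟩)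
    (fun z => ⟨pair A (ψ' z.1 + h.defectSqrt z.2) ⟨ψ z.2 - h.symm.defectSqrt z.1,
      sub_mem (h.mapsTo_idealSubmodule I z.2.2) (hS _)⟩, h.halmos_pair_eq hψ _ _⟩)
  exact ⟨Φ, fun x y => ⟨congrArg (·.1) (hΦ (pair A x y)), congrArg (·.2) (hΦ (pair A x y))⟩⟩

end Lift

end HilbertModule

end

theorem mainTheorem5 {A : Type*} [NonUnitalCStarAlgebra A] [PartialOrder A] [StarOrderedRing A]
    (I : TwoSidedIdeal A) [IsClosed (I : Set A)]
    {H : Type*} [NormedAddCommGroup H] [NormedSpace ℂ H] [SMul A H] [CStarModule A H]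
    [CompleteSpace H]
    {E : Type*} [NormedAddCommGroup E] [NormedSpace ℂ E] [SMul A E] [CStarModule A E]
    [CompleteSpace E]
    (hH : IsCountablyGenerated A H) (hE : IsCountablyGenerated A E)
    (φ : Iso I.ringCon.Quotient (H ⧸ idealSubmodule H I) (E ⧸ idealSubmodule E I)) :
    ∃ Φ : Iso A C⋆ᵐᵒᵈ(A, H × idealSubmodule E I) C⋆ᵐᵒᵈ(A, E × idealSubmodule H I),
      -- `Φ` lifts `φ`
      (∀ (h : H) (y : idealSubmodule E I),
        (Submodule.Quotient.mk (Φ (pair A h y)).1 : E ⧸ idealSubmodule E I) =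
          φ (Submodule.Quotient.mk h)) ∧
      -- `Φ` is the restriction of the unitary matrix `U` built from a contractive lift `ψ` of `φ`
      ∃ (ψ : H →L[ℂ] E) (ψ' : E →L[ℂ] H) (R : H →L[ℂ] H) (S : E →L[ℂ] E)
        (U : Iso A C⋆ᵐᵒᵈ(A, H × E) C⋆ᵐᵒᵈ(A, E × H)),
        IsAdjoint A ψ ψ' ∧ ‖ψ‖ ≤ 1 ∧
        (∀ h : H, (Submodule.Quotient.mk (ψ h) : E ⧸ idealSubmodule E I) =
          φ (Submodule.Quotient.mk h)) ∧
        IsPositiveSqrt A R (ContinuousLinearMap.id ℂ H - ψ' ∘L ψ) ∧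
        IsPositiveSqrt A S (ContinuousLinearMap.id ℂ E - ψ ∘L ψ') ∧
        (∀ (h : H) (e : E), U (pair A h e) = pair A (ψ h - S e) (R h + ψ' e)) ∧
        (∀ (h : H) (y : idealSubmodule E I),
          (Φ (pair A h y)).1 = (U (pair A h (y : E))).1 ∧
          ((Φ (pair A h y)).2 : H) = (U (pair A h (y : E))).2) := by
  obtain ⟨ψ, ψ', hadj, hψ, hlift⟩ := φ.exists_contraction_lift hH hE
  have hψ' : ‖ψ'‖ ≤ 1 := hadj.norm_eq ▸ hψ
  have hR (x : H) : hadj.defectSqrt x ∈ idealSubmodule H I :=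
    hadj.defectSqrt_apply_mem_idealSubmodule hψ ((hlift x).inner_sub_mem (hlift x))
  have hS (y : E) : hadj.symm.defectSqrt y ∈ idealSubmodule E I := by
    have hy := Iso.Rel.adjoint hadj hlift y
    refine hadj.symm.defectSqrt_apply_mem_idealSubmodule hψ' ?_
    rw [← neg_sub]
    exact I.neg_mem (hy.inner_sub_mem hy)
  obtain ⟨Φ, hΦ⟩ := hadj.exists_halmos_restrict hψ hR hS
  refine ⟨Φ, fun h y => ?_, ψ, ψ', hadj.defectSqrt, hadj.symm.defectSqrt, hadj.halmos hψ, hadj, hψ,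
    hlift, hadj.isPositiveSqrt_defectSqrt hψ, hadj.symm.isPositiveSqrt_defectSqrt hψ',
    hadj.halmos_pair hψ, hΦ⟩
  rw [(hΦ h y).1]
  exact (hlift h).sub_mem_right (hS y)
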